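/- All graphs are finite and simple. A connected graph with $N$ vertices and $N+1$ edges is called bicyclic. For integers $n,t$ with $0\le t\le n-5$, a $t$-cone bicyclic graph on $n$ vertices is a join $K_t\vee H$, where $H$ is a bicyclic graph with $n-t$ vertices ($K_0$ is the null graph, so $K_0\vee H=H$). For a real number $\alpha\ge 0$, let $\Theta(G,\alpha)$ be the largest eigenvalue of $A(G)+\alpha D(G)$, where $A(G)$ is the adjacency matrix and $D(G)$ the diagonal matrix of vertex degrees of $G$. Degree sequences are written in non-increasing order, and $a^{(m)}$ means that the entry $a$ is repeated $m$ times. For two non-increasing sequences $\pi=(d_1,\dots,d_n)$ and $\pi'=(d_1',\dots,d_n')$ write $\pi\lhd\pi'$ if $\pi\neq\pi'$, $\sum_{i=1}^k d_i\le\sum_{i=1}^k d_i'$ for $1\le k\le n-1$, and $\sum_{i=1}^n d_i=\sum_{i=1}^n d_i'$. Write $\pi\lhd^*\pi'$ (star majorization) if $\pi\lhd\pi'$ and $\pi,\pi'$ differ in exactly two positions, by exactly $1$ in each; that is, there are $p<q$ with $d_p'=d_p+1$, $d_q'=d_q-1$ and $d_i'=d_i$ for all $i\ne p,q$. **Theorem.**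 Let $\alpha\ge 0$ and $0\le t\le n-5$. Let $\pi$ and $\pi'$ be degree sequences of $t$-cone bicyclic graphs on $n$ vertices with $\pi\lhd^*\pi'$, and suppose that there is no integer $k$ with $1\le k\le n-t-5$ such that $$\pi=\left((n-1)^{(t)},\,t+k+3,\,t+3,\,(t+2)^{(n-t-k-2)},\,(t+1)^{(k)}\right)\quad\text{and}\quad \pi'=\left((n-1)^{(t)},\,t+k+4,\,(t+2)^{(n-t-k-1)},\,(t+1)^{(k)}\right).$$ Let $G_\pi$ (respectively $G_{\pi'}$) be a graph with largest $\Theta(\cdot,\alpha)$ among all $t$-cone bicyclic graphs with degree sequence $\pi$ (respectively $\pi'$). Then $\Theta(G_\pi,\alpha)<\Theta(G_{\pi'},\alpha)$. -/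

import Mathlib

open scoped Classical in
/-- The general matrix `M_α(G) = A(G) + α D(G)` of a finite simple graph, where `A(G)` is the
adjacency matrix and `D(G)` the diagonal matrix of vertex degrees. -/
noncomputable def generalMatrix {V : Type*} [Fintype V] (G : SimpleGraph V) (α : ℝ) :
    Matrix V V ℝ :=
  G.adjMatrix ℝ + α • G.degMatrix ℝ

/-- The general spectral radius `Θ(G, α)`: the maximal eigenvalue of `M_α(G)`. The set of real
eigenvalues is finite, and nonempty when `V` is nonempty, so the supremum is a maximum; see
`generalSpectralRadius_isGreatest`. -/
noncomputable def generalSpectralRadius {V : Type*} [Fintype V] (G : SimpleGraph V) (α : ℝ) : ℝ :=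
  sSup {μ : ℝ | Module.End.HasEigenvalue (Matrix.mulVecLin (generalMatrix G α)) μ}

theorem generalSpectralRadius_isGreatest {V : Type*} [Fintype V] [Nonempty V]
    (G : SimpleGraph V) (α : ℝ) :
    IsGreatest {μ : ℝ | Module.End.HasEigenvalue (Matrix.mulVecLin (generalMatrix G α)) μ}
      (generalSpectralRadius G α) := by
  classical
  have hfin : {μ : ℝ | Module.End.HasEigenvalue
      (Matrix.mulVecLin (generalMatrix G α)) μ}.Finite :=
    Module.End.finite_hasEigenvalue _
  have hherm : (generalMatrix G α).IsHermitian := by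
    have h : (generalMatrix G α).IsSymm := by
      ext i j
      simp [generalMatrix, SimpleGraph.degMatrix, Matrix.diagonal_apply, SimpleGraph.adj_comm,
        eq_comm]
      grind
    rw [Matrix.IsHermitian, Matrix.conjTranspose_eq_transpose_of_trivial]
    exact h
  have hne : {μ : ℝ | Module.End.HasEigenvalue
      (Matrix.mulVecLin (generalMatrix G α)) μ}.Nonempty := by
    obtain ⟨v⟩ := ‹Nonempty V›
    refine ⟨hherm.eigenvalues v, ?_⟩
    have h1 := hherm.mulVec_eigenvectorBasis v
    refine Module.End.hasEigenvalue_of_hasEigenvector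
      (x := (hherm.eigenvectorBasis v : V → ℝ)) ⟨?_, ?_⟩
    · rw [Module.End.mem_eigenspace_iff]
      simpa using h1
    · intro h0
      exact hherm.eigenvectorBasis.toBasis.ne_zero v (by
        ext i
        simpa using congrFun h0 i)
  exact ⟨hne.csSup_mem hfin, fun x hx => le_csSup hfin.bddAbove hx⟩

/-- The join `G ∨ H` of two vertex-disjoint graphs: the disjoint union together with all edges
between the vertices of `G` and the vertices of `H`. -/
def graphJoin {V W : Type*} (G : SimpleGraph V) (H : SimpleGraph W) : SimpleGraph (V ⊕ W) :=
  (G ⊕g H) ⊔ completeBipartiteGraph V W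

/-- A `c`-cyclic graph is a connected graph with `m = n + c - 1` edges, where `n` is the number of
vertices. -/
def IsCyclicGraph {V : Type*} (c : ℕ) (G : SimpleGraph V) : Prop :=
  G.Connected ∧ G.edgeSet.ncard + 1 = Nat.card V + c

/-- A `t`-cone `c`-cyclic graph on `n` vertices: a graph isomorphic to `K_t ∨ H`, where `H` is a
`c`-cyclic graph with `n - t` vertices. -/
def IsConeCyclicGraph {n : ℕ} (t c : ℕ) (G : SimpleGraph (Fin n)) : Prop :=
  t ≤ n ∧ ∃ H : SimpleGraph (Fin (n - t)), IsCyclicGraph c H ∧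
    Nonempty (G ≃g graphJoin (⊤ : SimpleGraph (Fin t)) H)

/-- `d` is the degree sequence of `G`, written in non-increasing order. -/
def HasDegreeSequence {n : ℕ} (G : SimpleGraph (Fin n)) (d : Fin n → ℕ) : Prop :=
  Antitone d ∧ ∃ σ : Equiv.Perm (Fin n), ∀ i, (G.neighborSet (σ i)).ncard = d i

/-- The class `Γ(π, t; c)` of `t`-cone `c`-cyclic graphs with degree sequence `π = d`. -/
def coneCyclicClass {n : ℕ} (d : Fin n → ℕ) (t c : ℕ) : Set (SimpleGraph (Fin n)) :=
  {G | IsConeCyclicGraph t c G ∧ HasDegreeSequence G d}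

/-- `G` is a `Θ_α`-maximal graph of the class `𝒢`. -/
def IsThetaMaximal {n : ℕ} (α : ℝ) (𝒢 : Set (SimpleGraph (Fin n))) (G : SimpleGraph (Fin n)) :
    Prop :=
  G ∈ 𝒢 ∧ ∀ G₁ ∈ 𝒢, generalSpectralRadius G₁ α ≤ generalSpectralRadius G α

/-- Majorization `y ⊴ z` of non-increasing sequences: every partial sum of `y` is at most the
corresponding partial sum of `z`, and the total sums agree. -/
def IsMajorizedBy {n : ℕ} (y z : Fin n → ℕ) : Prop :=
  Antitone y ∧ Antitone z ∧
    (∀ k : ℕ, ∑ i with i.val < k, y i ≤ ∑ i with i.val < k, z i) ∧ ∑ i, y i = ∑ i, z i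

/-- Star majorization `y ⊲* z`: `y` is strictly majorized by `z`, and the two sequences differ in
exactly two positions, in each of which the difference is `1`. -/
def IsStarMajorizedBy {n : ℕ} (y z : Fin n → ℕ) : Prop :=
  IsMajorizedBy y z ∧ y ≠ z ∧
    ∃ p q : Fin n, p < q ∧ z p = y p + 1 ∧ y q = z q + 1 ∧ ∀ i, i ≠ p → i ≠ q → y i = z i

/-- The exceptional pairs of sequences (exponents denote repetition), for `1 ≤ k ≤ n - t - 5`:
`d  = ((n-1)^(t), t+k+3, t+3, (t+2)^(n-t-k-2), (t+1)^(k))` and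
`d' = ((n-1)^(t), t+k+4, (t+2)^(n-t-k-1), (t+1)^(k))`. -/
def IsExceptionalPair {n : ℕ} (t : ℕ) (d d' : Fin n → ℕ) : Prop :=
  ∃ k : ℕ, 1 ≤ k ∧ k + t + 5 ≤ n ∧
    List.ofFn d = List.replicate t (n - 1) ++ [t + k + 3, t + 3] ++
      List.replicate (n - t - k - 2) (t + 2) ++ List.replicate k (t + 1) ∧
    List.ofFn d' = List.replicate t (n - 1) ++ [t + k + 4] ++
      List.replicate (n - t - k - 1) (t + 2) ++ List.replicate k (t + 1)

/-! Write `G` as a cone over a bicyclic graph `H`, and let `f` be the restriction to `H` of the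
Perron vector of the cone. Changing `H` changes the quadratic form of the cone by exactly the change
of the form of `H` at `f` (`quadForm_join_sub`). Maximality of `G` therefore says that `H` maximizes
this form among bicyclic graphs with its degrees (`IsExtremalWeight`); in particular larger degree
implies at least as large weight (`le_of_vdeg_lt`).

Let `u`, `v` be the vertices of `H` at the two positions where the sequences differ, of degrees `a ≥
b ≥ 2`, with `f v ≤ f u`. It suffices to move one unit of degree from a vertex of degree `b` to a
vertex of degree `a`, keeping `H` connected, without lowering the form and while raising some row:
the spectral radius then strictly grows, and the new cone has the larger degree sequence.

Replacing an edge `vw` by `uw` does this whenever it is possible. If it never is, all neighbours of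
`v` other than `u` are neighbours of `u`. A bicyclic graph spans at most `k + 1` edges on `k`
vertices, so `b ≤ 3`. If equality holds for a set, the rest of the graph is a forest growing out of
it (`IsTightCore`). Now two edges are replaced at once, `vw`, `yx` by `yw`, `ux`, with gain `2 (f x
(f u - f v) + (f w - f x) (f y - f v)) + α (f u ^ 2 - f v ^ 2)`.

For `b = 3` (`improvable_of_three`) the nesting gives a `K_{2,3}` or a diamond; the diamond needs a
third vertex of degree at least three, and only the exceptional pairs lack one when `a ≥ 4`. For `b
= 2` (`improvable_of_two`), at least five vertices are not leaves; failure of all moves forces a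
triangle `u`, `v`, `w` with every leaf attached to `u` or `w`, and a degree count excludes this. -/

/-! ### Row sums, quadratic form and the spectral radius -/

open scoped Classical in
/-- The sum of the values of `g` over the neighbours of `x`. -/
noncomputable def nsum {V : Type*} [Fintype V] (G : SimpleGraph V) (g : V → ℝ) (x : V) : ℝ :=
  ∑ y, if G.Adj x y then g y else 0

/-- The degree of a vertex, without decidability assumptions. -/
noncomputable def vdeg {V : Type*} (G : SimpleGraph V) (x : V) : ℕ := (G.neighborSet x).ncard

/-- The entry at `x` of `M_α(G) g`. -/
noncomputable def mrow {V : Type*} [Fintype V] (G : SimpleGraph V) (α : ℝ) (g : V → ℝ) (x : V) :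
    ℝ :=
  nsum G g x + α * vdeg G x * g x

/-- The quadratic form of `M_α(G)`. -/
noncomputable def quadForm {V : Type*} [Fintype V] (G : SimpleGraph V) (α : ℝ) (g : V → ℝ) : ℝ :=
  ∑ x, g x * mrow G α g x

section Spectral

variable {V : Type*} [Fintype V]

theorem vdeg_eq_degree (G : SimpleGraph V) [DecidableRel G.Adj] (x : V) :
    vdeg G x = G.degree x := by
  rw [vdeg, Set.ncard_eq_toFinset_card', SimpleGraph.degree, SimpleGraph.neighborFinset]

theorem nsum_one (G : SimpleGraph V) (x : V) : nsum G (fun _ => 1) x = vdeg G x := by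
  classical
  rw [nsum, vdeg_eq_degree, Finset.sum_boole, ← SimpleGraph.card_neighborFinset_eq_degree]
  congr 2
  ext y
  simp

theorem generalMatrix_mulVec (G : SimpleGraph V) (α : ℝ) (g : V → ℝ) (x : V) :
    (generalMatrix G α).mulVec g x = mrow G α g x := by
  classical
  have h : (generalMatrix G α).mulVec g x = ∑ y, generalMatrix G α x y * g y := rfl
  rw [h]
  simp only [generalMatrix, Matrix.add_apply, Matrix.smul_apply, SimpleGraph.adjMatrix_apply,
    SimpleGraph.degMatrix, Matrix.diagonal_apply, add_mul, Finset.sum_add_distrib, mrow, nsum]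
  congr 1
  · refine Finset.sum_congr rfl fun y _ => ?_
    split_ifs <;> simp
  · rw [Finset.sum_eq_single x]
    · simp only [if_true, smul_eq_mul]
      rw [vdeg_eq_degree]
    · intro b _ hb
      simp [Ne.symm hb]
    · simp

theorem generalMatrix_isHermitian (G : SimpleGraph V) (α : ℝ) :
    (generalMatrix G α).IsHermitian := by
  classical
  ext i j
  simp [generalMatrix, SimpleGraph.degMatrix, Matrix.diagonal_apply, SimpleGraph.adj_comm,
    eq_comm]
  grind

theorem hasEigenvalue_of_mrow (G : SimpleGraph V) (α μ : ℝ) (g : V → ℝ) (hg : g ≠ 0)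
    (h : ∀ x, mrow G α g x = μ * g x) :
    Module.End.HasEigenvalue (Matrix.mulVecLin (generalMatrix G α)) μ := by
  refine Module.End.hasEigenvalue_of_hasEigenvector (x := g) ⟨?_, hg⟩
  rw [Module.End.mem_eigenspace_iff]
  ext x
  simp [generalMatrix_mulVec, h]

theorem exists_mrow_of_hasEigenvalue (G : SimpleGraph V) (α μ : ℝ)
    (h : Module.End.HasEigenvalue (Matrix.mulVecLin (generalMatrix G α)) μ) :
    ∃ g : V → ℝ, g ≠ 0 ∧ ∀ x, mrow G α g x = μ * g x := by
  obtain ⟨g, hg⟩ := h.exists_hasEigenvector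
  refine ⟨g, hg.2, fun x => ?_⟩
  have := congrFun (Module.End.mem_eigenspace_iff.1 hg.1) x
  simpa [generalMatrix_mulVec] using this

/-- An eigenvector of the difference with eigenvalue `c` is an eigenvector of `M_α(G)` with
eigenvalue `Θ - c`, which is at most `Θ`. This yields both the Rayleigh bound and its equality case.
-/
theorem posSemidef_sub_generalMatrix [Nonempty V] [DecidableEq V] (G : SimpleGraph V) (α : ℝ) :
    (generalSpectralRadius G α • (1 : Matrix V V ℝ) - generalMatrix G α).PosSemidef := by
  have hB : (generalSpectralRadius G α • (1 : Matrix V V ℝ) - generalMatrix G α).IsHermitian := by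
    refine Matrix.IsHermitian.sub ?_ (generalMatrix_isHermitian G α)
    simp [Matrix.IsHermitian]
  rw [hB.posSemidef_iff_eigenvalues_nonneg]
  intro i
  have h1 := hB.mulVec_eigenvectorBasis i
  set g : V → ℝ := (hB.eigenvectorBasis i : V → ℝ) with hgdef
  have hg : g ≠ 0 := by
    intro h0
    exact hB.eigenvectorBasis.toBasis.ne_zero i (by
      ext j
      simpa using congrFun h0 j)
  have h2 : ∀ x, mrow G α g x = (generalSpectralRadius G α - hB.eigenvalues i) * g x := by
    intro x
    have h3 := congrFun h1 x
    rw [Matrix.sub_mulVec, Matrix.smul_mulVec, Matrix.one_mulVec] at h3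
    simp only [Pi.sub_apply, Pi.smul_apply, smul_eq_mul, generalMatrix_mulVec] at h3
    linarith
  have := (generalSpectralRadius_isGreatest G α).2 (hasEigenvalue_of_mrow G α _ g hg h2)
  simp only [Pi.zero_apply]
  linarith

theorem sub_generalMatrix_mulVec [DecidableEq V] (G : SimpleGraph V) (α c : ℝ) (g : V → ℝ) (x : V) :
    (c • (1 : Matrix V V ℝ) - generalMatrix G α).mulVec g x = c * g x - mrow G α g x := by
  rw [Matrix.sub_mulVec, Matrix.smul_mulVec, Matrix.one_mulVec]
  simp [generalMatrix_mulVec]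

theorem dotProduct_sub_generalMatrix [DecidableEq V] (G : SimpleGraph V) (α c : ℝ) (g : V → ℝ) :
    star g ⬝ᵥ (c • (1 : Matrix V V ℝ) - generalMatrix G α).mulVec g =
      c * ∑ x, g x * g x - quadForm G α g := by
  simp only [dotProduct, sub_generalMatrix_mulVec, quadForm, Finset.mul_sum,
    ← Finset.sum_sub_distrib]
  refine Finset.sum_congr rfl fun x _ => ?_
  simp
  ring

theorem quadForm_le [Nonempty V] (G : SimpleGraph V) (α : ℝ) (g : V → ℝ) :
    quadForm G α g ≤ generalSpectralRadius G α * ∑ x, g x * g x := by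
  classical
  have h := (posSemidef_sub_generalMatrix G α).dotProduct_mulVec_nonneg g
  rw [dotProduct_sub_generalMatrix] at h
  linarith

theorem mrow_eq_of_quadForm_eq [Nonempty V] (G : SimpleGraph V) (α : ℝ) (g : V → ℝ)
    (h : quadForm G α g = generalSpectralRadius G α * ∑ x, g x * g x) (x : V) :
    mrow G α g x = generalSpectralRadius G α * g x := by
  classical
  have h1 := ((posSemidef_sub_generalMatrix G α).dotProduct_mulVec_zero_iff g).1 (by
    rw [dotProduct_sub_generalMatrix]; linarith)
  have h2 := congrFun h1 x
  rw [sub_generalMatrix_mulVec] at h2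
  simp only [Pi.zero_apply] at h2
  linarith

theorem quadForm_of_eigen (G : SimpleGraph V) (α μ : ℝ) (g : V → ℝ)
    (h : ∀ x, mrow G α g x = μ * g x) : quadForm G α g = μ * ∑ x, g x * g x := by
  simp only [quadForm, h, Finset.mul_sum]
  exact Finset.sum_congr rfl fun x _ => by ring

theorem sum_mul_self_pos {g : V → ℝ} (hg : g ≠ 0) : 0 < ∑ x, g x * g x := by
  obtain ⟨x, hx⟩ := Function.ne_iff.1 hg
  exact Finset.sum_pos' (fun y _ => mul_self_nonneg _) ⟨x, Finset.mem_univ _, by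
    simpa using hx⟩

/-- Taking absolute values of a top eigenvector does not lower the form: off-diagonal entries are
nonnegative and the diagonal terms do not change. The result attains the Rayleigh bound, hence is an
eigenvector, and a zero would spread along edges to the whole connected graph. -/
theorem exists_perron_vector [Nonempty V] (G : SimpleGraph V) (hG : G.Connected) (α : ℝ) :
    ∃ g : V → ℝ, (∀ x, 0 < g x) ∧ ∀ x, mrow G α g x = generalSpectralRadius G α * g x := by
  classical
  obtain ⟨y, hy0, hy⟩ := exists_mrow_of_hasEigenvalue G α _ (generalSpectralRadius_isGreatest G α).1
  have hq := quadForm_of_eigen G α _ y hy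
  set g : V → ℝ := fun x => |y x| with hgdef
  have hle : quadForm G α y ≤ quadForm G α g := by
    refine Finset.sum_le_sum fun x _ => ?_
    simp only [mrow, nsum, mul_add, Finset.mul_sum]
    refine add_le_add (Finset.sum_le_sum fun z _ => ?_) (le_of_eq ?_)
    · split_ifs
      · rw [hgdef]
        simp only
        rw [← abs_mul]
        exact le_abs_self _
      · simp
    · rw [hgdef]
      simp only
      have : |y x| * |y x| = y x * y x := abs_mul_abs_self _
      linear_combination -(α * vdeg G x) * this
  have hss : ∑ x, g x * g x = ∑ x, y x * y x :=
    Finset.sum_congr rfl fun x _ => abs_mul_abs_self _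
  have heq : quadForm G α g = generalSpectralRadius G α * ∑ x, g x * g x :=
    le_antisymm (quadForm_le G α g) (by rw [hss, ← hq]; exact hle)
  have hrow := mrow_eq_of_quadForm_eq G α g heq
  have hg0 : ∀ x, 0 ≤ g x := fun x => abs_nonneg _
  have hstep : ∀ a b, G.Adj a b → g a = 0 → g b = 0 := by
    intro a b hab ha
    have h1 := hrow a
    simp only [mrow, ha, mul_zero, add_zero, nsum] at h1
    have h2 := (Finset.sum_eq_zero_iff_of_nonneg (fun z _ => by
      split_ifs
      · exact hg0 z
      · exact le_rfl)).1 h1 b (Finset.mem_univ _)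
    simpa [hab] using h2
  refine ⟨g, fun x => ?_, hrow⟩
  by_contra hx
  have hx0 : g x = 0 := le_antisymm (not_lt.1 hx) (hg0 x)
  have hall : ∀ z, G.Reachable x z → g z = 0 := by
    intro z hz
    obtain ⟨p⟩ := hz
    revert hx0
    clear hx
    induction p with
    | nil => exact id
    | cons h p ih => exact fun h0 => ih (hstep _ _ h h0)
  exact hy0 (funext fun z => by
    have := hall z (hG.preconnected x z)
    simpa [hgdef] using this)

theorem spectralRadius_lt_of_quadForm_lt [Nonempty V] (G G₂ : SimpleGraph V) {α : ℝ} (g : V → ℝ)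
    (hg : g ≠ 0) (h : ∀ x, mrow G α g x = generalSpectralRadius G α * g x)
    (hq : quadForm G α g < quadForm G₂ α g) :
    generalSpectralRadius G α < generalSpectralRadius G₂ α := by
  have h1 := quadForm_of_eigen G α _ g h
  have h2 := quadForm_le G₂ α g
  have h3 := sum_mul_self_pos hg
  by_contra hcon
  have := mul_le_mul_of_nonneg_right (not_lt.1 hcon) h3.le
  linarith

/-- Strictness comes from the rows: if the two radii were equal, `g` would be a top eigenvector of
both graphs and all rows would agree. -/
theorem spectralRadius_lt_of_mrow_ne [Nonempty V] (G G₂ : SimpleGraph V) {α : ℝ} (g : V → ℝ)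
    (hg : g ≠ 0) (h : ∀ x, mrow G α g x = generalSpectralRadius G α * g x)
    (hq : quadForm G α g ≤ quadForm G₂ α g) (z : V) (hz : mrow G α g z ≠ mrow G₂ α g z) :
    generalSpectralRadius G α < generalSpectralRadius G₂ α := by
  rcases hq.lt_or_eq with hlt | heq
  · exact spectralRadius_lt_of_quadForm_lt G G₂ g hg h hlt
  have h1 := quadForm_of_eigen G α _ g h
  have h2 := quadForm_le G₂ α g
  have h3 := sum_mul_self_pos hg
  have hle : generalSpectralRadius G α ≤ generalSpectralRadius G₂ α :=
    le_of_mul_le_mul_right (by linarith) h3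
  refine hle.lt_of_ne fun he => hz ?_
  rw [h z, he]
  exact (mrow_eq_of_quadForm_eq G₂ α g (by rw [← heq, h1, he]) z).symm

end Spectral

/-! ### Invariance under isomorphism -/

theorem vdeg_iso {V W : Type*} {G : SimpleGraph V} {K : SimpleGraph W} (e : G ≃g K) (x : V) :
    vdeg K (e x) = vdeg G x := by
  have h : K.neighborSet (e x) = e '' G.neighborSet x := by
    ext y
    simp only [SimpleGraph.mem_neighborSet, Set.mem_image]
    constructor
    · intro h
      refine ⟨e.symm y, ?_, by simp⟩
      rw [← e.map_adj_iff]
      simpa using h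
    · rintro ⟨z, hz, rfl⟩
      exact e.map_adj_iff.2 hz
  rw [vdeg, h, Set.ncard_image_of_injective _ e.injective, vdeg]

theorem mrow_iso {V W : Type*} [Fintype V] [Fintype W] {G : SimpleGraph V} {K : SimpleGraph W}
    (e : G ≃g K) (α : ℝ) (g : W → ℝ) (x : V) :
    mrow G α (g ∘ e) x = mrow K α g (e x) := by
  classical
  simp only [mrow, vdeg_iso e, Function.comp_apply, nsum]
  congr 1
  refine Fintype.sum_equiv e.toEquiv _ _ fun y => ?_
  have : K.Adj (e x) (e y) ↔ G.Adj x y := e.map_adj_iff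
  simp [this]

theorem hasEigenvalue_iso {V W : Type*} [Fintype V] [Fintype W] {G : SimpleGraph V}
    {K : SimpleGraph W} (e : G ≃g K) (α μ : ℝ)
    (h : Module.End.HasEigenvalue (Matrix.mulVecLin (generalMatrix K α)) μ) :
    Module.End.HasEigenvalue (Matrix.mulVecLin (generalMatrix G α)) μ := by
  obtain ⟨g, hg, hrow⟩ := exists_mrow_of_hasEigenvalue K α μ h
  refine hasEigenvalue_of_mrow G α μ (g ∘ e) (fun h0 => hg ?_) fun x => ?_
  · ext y
    simpa using congrFun h0 (e.symm y)
  · rw [mrow_iso, hrow]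
    rfl

theorem generalSpectralRadius_iso {V W : Type*} [Fintype V] [Fintype W] {G : SimpleGraph V}
    {K : SimpleGraph W} (e : G ≃g K) (α : ℝ) :
    generalSpectralRadius G α = generalSpectralRadius K α := by
  unfold generalSpectralRadius
  congr 1
  ext μ
  exact ⟨hasEigenvalue_iso e.symm α μ, hasEigenvalue_iso e α μ⟩

/-! ### Joins with a complete graph -/

section Join

variable {T W : Type*}

@[simp] theorem graphJoin_adj_inl_inl (G : SimpleGraph T) (H : SimpleGraph W) (i j : T) :
    (graphJoin G H).Adj (Sum.inl i) (Sum.inl j) ↔ G.Adj i j := by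
  simp [graphJoin]

@[simp] theorem graphJoin_adj_inr_inr (G : SimpleGraph T) (H : SimpleGraph W) (x y : W) :
    (graphJoin G H).Adj (Sum.inr x) (Sum.inr y) ↔ H.Adj x y := by
  simp [graphJoin]

@[simp] theorem graphJoin_adj_inl_inr (G : SimpleGraph T) (H : SimpleGraph W) (i : T) (y : W) :
    (graphJoin G H).Adj (Sum.inl i) (Sum.inr y) := by
  simp [graphJoin]

@[simp] theorem graphJoin_adj_inr_inl (G : SimpleGraph T) (H : SimpleGraph W) (i : T) (y : W) :
    (graphJoin G H).Adj (Sum.inr y) (Sum.inl i) := by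
  simp [graphJoin]

theorem graphJoin_connected (G : SimpleGraph T) {H : SimpleGraph W} (hH : H.Connected) :
    (graphJoin G H).Connected := by
  obtain ⟨w⟩ := hH.nonempty
  have hr : ∀ y : W, (graphJoin G H).Reachable (Sum.inr w) (Sum.inr y) := by
    intro y
    obtain ⟨p⟩ := hH.preconnected w y
    exact ⟨p.map ⟨Sum.inr, by intro a b h; simpa using h⟩⟩
  have hall : ∀ z : T ⊕ W, (graphJoin G H).Reachable (Sum.inr w) z := by
    rintro (i | y)
    · exact SimpleGraph.Adj.reachable (by simp)
    · exact hr y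
  have : Nonempty (T ⊕ W) := ⟨Sum.inr w⟩
  exact ⟨fun a b => (hall a).symm.trans (hall b)⟩

variable [Fintype T] [Fintype W]

theorem nsum_join_inl (G : SimpleGraph T) (H : SimpleGraph W) (g : T ⊕ W → ℝ) (i : T) :
    nsum (graphJoin G H) g (Sum.inl i) = nsum G (g ∘ Sum.inl) i + ∑ y, g (Sum.inr y) := by
  classical
  simp only [nsum, Fintype.sum_sum_type]
  congr 1
  · exact Finset.sum_congr rfl fun y _ => if_congr (graphJoin_adj_inl_inl G H i y) rfl rfl
  · exact Finset.sum_congr rfl fun y _ => if_pos (graphJoin_adj_inl_inr G H i y)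

theorem nsum_join_inr (G : SimpleGraph T) (H : SimpleGraph W) (g : T ⊕ W → ℝ) (x : W) :
    nsum (graphJoin G H) g (Sum.inr x) = ∑ i, g (Sum.inl i) + nsum H (g ∘ Sum.inr) x := by
  classical
  simp only [nsum, Fintype.sum_sum_type]
  congr 1
  · exact Finset.sum_congr rfl fun y _ => if_pos (graphJoin_adj_inr_inl G H y x)
  · exact Finset.sum_congr rfl fun y _ => if_congr (graphJoin_adj_inr_inr G H x y) rfl rfl

theorem vdeg_join_inl (G : SimpleGraph T) (H : SimpleGraph W) (i : T) :
    vdeg (graphJoin G H) (Sum.inl i) = vdeg G i + Fintype.card W := by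
  have h := nsum_join_inl G H (fun _ => 1) i
  rw [nsum_one] at h
  have h2 : nsum G ((fun _ => (1 : ℝ)) ∘ (Sum.inl : T → T ⊕ W)) i = vdeg G i := nsum_one G i
  rw [h2] at h
  simp at h
  exact_mod_cast h

theorem vdeg_join_inr (G : SimpleGraph T) (H : SimpleGraph W) (x : W) :
    vdeg (graphJoin G H) (Sum.inr x) = Fintype.card T + vdeg H x := by
  have h := nsum_join_inr G H (fun _ => 1) x
  rw [nsum_one] at h
  have h2 : nsum H ((fun _ => (1 : ℝ)) ∘ (Sum.inr : W → T ⊕ W)) x = vdeg H x := nsum_one H x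
  rw [h2] at h
  simp at h
  exact_mod_cast h

theorem mrow_join_inr_sub (G : SimpleGraph T) (H H₂ : SimpleGraph W) (α : ℝ) (g : T ⊕ W → ℝ)
    (x : W) :
    mrow (graphJoin G H₂) α g (Sum.inr x) - mrow (graphJoin G H) α g (Sum.inr x) =
      mrow H₂ α (g ∘ Sum.inr) x - mrow H α (g ∘ Sum.inr) x := by
  simp only [mrow, nsum_join_inr, vdeg_join_inr, Function.comp_apply]
  push_cast
  ring

/-- Rows at the vertices of `G` do not see `H`, and at the vertices of `H` the contribution of `G`
cancels. -/
theorem quadForm_join_sub (G : SimpleGraph T) (H H₂ : SimpleGraph W) (α : ℝ) (g : T ⊕ W → ℝ) :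
    quadForm (graphJoin G H₂) α g - quadForm (graphJoin G H) α g =
      quadForm H₂ α (g ∘ Sum.inr) - quadForm H α (g ∘ Sum.inr) := by
  simp only [quadForm, Fintype.sum_sum_type]
  have h1 : ∀ i : T, mrow (graphJoin G H₂) α g (Sum.inl i) =
      mrow (graphJoin G H) α g (Sum.inl i) := fun i => by
    simp only [mrow, nsum_join_inl, vdeg_join_inl]
  simp only [h1]
  rw [add_sub_add_left_eq_sub, ← Finset.sum_sub_distrib, ← Finset.sum_sub_distrib]
  refine Finset.sum_congr rfl fun x _ => ?_
  rw [← mul_sub, mrow_join_inr_sub]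
  simp only [Function.comp_apply, mul_sub]

end Join

/-! ### Moving edges -/

section Basic

variable {W : Type*}

theorem SimpleGraph.Connected.exists_adj_dist_add_one {H : SimpleGraph W} (hH : H.Connected)
    (u : W) {x : W} (hx : x ≠ u) : ∃ p, H.Adj x p ∧ H.dist u p + 1 = H.dist u x := by
  obtain ⟨q, hq⟩ := hH.exists_walk_length_eq_dist x u
  cases q with
  | nil => exact absurd rfl hx
  | cons h r =>
    rename_i p
    refine ⟨p, h, ?_⟩
    rw [SimpleGraph.Walk.length_cons] at hq
    have h1 : H.dist p u ≤ r.length := SimpleGraph.dist_le r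
    have h2 : H.dist x u ≤ H.dist x p + H.dist p u := hH.dist_triangle
    rw [SimpleGraph.dist_eq_one_iff_adj.2 h] at h2
    rw [SimpleGraph.dist_comm (u := u) (v := p), SimpleGraph.dist_comm (u := u) (v := x)]
    omega

theorem SimpleGraph.Connected.of_adj_reachable {H H₂ : SimpleGraph W} (hH : H.Connected)
    (h : ∀ a b, H.Adj a b → H₂.Reachable a b) : H₂.Connected := by
  have : Nonempty W := hH.nonempty
  refine ⟨fun a b => ?_⟩
  obtain ⟨p⟩ := hH.preconnected a b
  induction p with
  | nil => exact SimpleGraph.Reachable.refl _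
  | cons hab p ih => exact (h _ _ hab).trans ih

theorem exists_adj_ne_of_two_le_vdeg {H : SimpleGraph W} {x : W} (h : 2 ≤ vdeg H x) (p : W) :
    ∃ y, H.Adj x y ∧ y ≠ p :=
  Set.exists_ne_of_one_lt_ncard h p

variable [Fintype W]

theorem sum_vdeg (H : SimpleGraph W) : ∑ x, vdeg H x = 2 * H.edgeSet.ncard := by
  classical
  rw [Set.ncard_eq_toFinset_card']
  simp only [vdeg_eq_degree]
  rw [H.sum_degrees_eq_twice_card_edges, SimpleGraph.edgeFinset]

theorem isCyclicGraph_iff (c : ℕ) (H : SimpleGraph W) :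
    IsCyclicGraph c H ↔ H.Connected ∧ ∑ x, vdeg H x + 2 = 2 * (Fintype.card W + c) := by
  rw [IsCyclicGraph, sum_vdeg, Nat.card_eq_fintype_card]
  refine and_congr_right fun _ => ?_
  omega

theorem vdeg_pos_of_adj {H : SimpleGraph W} {x y : W} (h : H.Adj x y) : 0 < vdeg H x :=
  (Set.ncard_pos (Set.toFinite _)).2 ⟨y, h⟩

theorem two_le_vdeg {H : SimpleGraph W} {x y z : W} (hy : H.Adj x y) (hz : H.Adj x z)
    (hyz : y ≠ z) : 2 ≤ vdeg H x :=
  (Set.one_lt_ncard_iff (Set.toFinite _)).2 ⟨y, z, hy, hz, hyz⟩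

end Basic

/-- The graph obtained from `H` by replacing the edges `vs` by `us` for all `s ∈ S`. -/
def shiftEdges {W : Type*} (H : SimpleGraph W) (v u : W) (S : Finset W) : SimpleGraph W where
  Adj a b := a ≠ b ∧ ((H.Adj a b ∧ ¬ (a = v ∧ b ∈ S) ∧ ¬ (b = v ∧ a ∈ S)) ∨
    (a = u ∧ b ∈ S) ∨ (b = u ∧ a ∈ S))
  symm := by
    constructor
    intro a b h
    have := H.adj_comm a b
    tauto
  loopless := ⟨fun a h => h.1 rfl⟩

/-- The edges `vs` with `s ∈ S` may be replaced by `us`. -/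
structure Shiftable {W : Type*} (H : SimpleGraph W) (v u : W) (S : Finset W) : Prop where
  ne : u ≠ v
  adj : ∀ s ∈ S, H.Adj v s
  ne_target : ∀ s ∈ S, s ≠ u
  not_adj : ∀ s ∈ S, ¬ H.Adj u s

section Shift

variable {W : Type*} {H : SimpleGraph W} {v u : W} {S : Finset W}

theorem shiftEdges_adj_of_adj {a b : W} (h : H.Adj a b) (h1 : ¬ (a = v ∧ b ∈ S))
    (h2 : ¬ (b = v ∧ a ∈ S)) : (shiftEdges H v u S).Adj a b :=
  ⟨h.ne, Or.inl ⟨h, h1, h2⟩⟩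

theorem Shiftable.adj_new (hS : Shiftable H v u S) {s : W} (hs : s ∈ S) :
    (shiftEdges H v u S).Adj u s :=
  ⟨(hS.ne_target s hs).symm, Or.inr (Or.inl ⟨rfl, hs⟩)⟩

/-- Shortest paths from `u` to vertices nearer than `v` avoid `v`, so they survive. The kept
neighbour `p` then joins `v` to `u`, and a removed edge `vs` is replaced by a route through `u`. -/
theorem Shiftable.connected (hS : Shiftable H v u S) (hH : H.Connected) {p : W}
    (hp : H.Adj v p) (hpS : p ∉ S) (hd : H.dist u p < H.dist u v) :
    (shiftEdges H v u S).Connected := by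
  have key : ∀ k z, H.dist u z = k → H.dist u z < H.dist u v →
      (shiftEdges H v u S).Reachable u z := by
    intro k
    induction k using Nat.strong_induction_on with
    | _ k ih =>
      intro z hz hlt
      by_cases hzu : z = u
      · rw [hzu]
      obtain ⟨q, hq, hqd⟩ := hH.exists_adj_dist_add_one u hzu
      refine (ih _ (by omega) q rfl (by omega)).trans (SimpleGraph.Adj.reachable ?_)
      refine shiftEdges_adj_of_adj hq.symm ?_ ?_
      · rintro ⟨rfl, -⟩
        omega
      · rintro ⟨rfl, -⟩
        omega
  have huv : (shiftEdges H v u S).Reachable u v := by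
    refine (key _ p rfl hd).trans (SimpleGraph.Adj.reachable ?_)
    refine shiftEdges_adj_of_adj hp.symm ?_ ?_
    · rintro ⟨rfl, -⟩
      exact hp.ne rfl
    · rintro ⟨-, h⟩
      exact hpS h
  refine hH.of_adj_reachable fun a b hab => ?_
  by_cases h1 : a = v ∧ b ∈ S
  · rw [h1.1]
    exact huv.symm.trans (hS.adj_new h1.2).reachable
  by_cases h2 : b = v ∧ a ∈ S
  · rw [h2.1]
    exact (hS.adj_new h2.2).symm.reachable.trans huv
  · exact (shiftEdges_adj_of_adj hab h1 h2).reachable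

variable [Fintype W]

open scoped Classical in
theorem Shiftable.nsum (hS : Shiftable H v u S) (g : W → ℝ) (a : W) :
    nsum (shiftEdges H v u S) g a = nsum H g a + (if a = u then ∑ s ∈ S, g s else 0) -
      (if a = v then ∑ s ∈ S, g s else 0) + (if a ∈ S then g u - g v else 0) := by
  have hvS : v ∉ S := fun h => (hS.adj v h).ne rfl
  have huS : u ∉ S := fun h => hS.ne_target u h rfl
  have hind : ∀ b, (if (shiftEdges H v u S).Adj a b then g b else 0) =
      (if H.Adj a b then g b else 0) + (if a = u then (if b ∈ S then g b else 0) else 0) -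
      (if a = v then (if b ∈ S then g b else 0) else 0) +
      ((if a ∈ S then (if b = u then g b else 0) else 0) -
       (if a ∈ S then (if b = v then g b else 0) else 0)) := by
    intro b
    have hadj : (shiftEdges H v u S).Adj a b ↔ a ≠ b ∧
      ((H.Adj a b ∧ ¬ (a = v ∧ b ∈ S) ∧ ¬ (b = v ∧ a ∈ S)) ∨
        (a = u ∧ b ∈ S) ∨ (b = u ∧ a ∈ S)) := Iff.rfl
    have hne := hS.ne
    by_cases hb : b ∈ S
    · have h1 := hS.adj b hb
      have h2 := hS.not_adj b hb
      have h3 := hS.ne_target b hb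
      have h4 : b ≠ v := h1.ne'
      by_cases hau : a = u
      · subst hau
        simp [hadj, hb, h3, h4, huS, hne, h2, Ne.symm h3]
      · by_cases hav : a = v
        · subst hav
          simp [hadj, hb, h3, h4, hvS, Ne.symm hne, h1]
        · by_cases haS : a ∈ S
          · simp [hadj, hb, h3, h4, hau, hav]
            exact if_congr ⟨And.right, fun hq => ⟨hq.ne, hq⟩⟩ rfl rfl
          · simp [hadj, hb, h3, h4, hau, hav]
            exact if_congr ⟨And.right, fun hq => ⟨hq.ne, hq⟩⟩ rfl rfl
    · by_cases haS : a ∈ S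
      · have h1 := hS.adj a haS
        have h2 := hS.not_adj a haS
        have h3 := hS.ne_target a haS
        have h4 : a ≠ v := h1.ne'
        by_cases hbu : b = u
        · subst hbu
          simp [hadj, hb, haS, h3, hne, H.adj_comm a b, h2]
        · by_cases hbv : b = v
          · subst hbv
            simp [hadj, hb, haS, hbu, h1.symm]
          · simp [hadj, hb, haS, hbu, hbv]
            exact if_congr ⟨And.right, fun hq => ⟨hq.ne, hq⟩⟩ rfl rfl
      · simp [hadj, hb, haS]
        exact if_congr ⟨And.right, fun hq => ⟨hq.ne, hq⟩⟩ rfl rfl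
  unfold _root_.nsum
  simp only [hind, Finset.sum_add_distrib, Finset.sum_sub_distrib]
  have hite : ∀ (p : Prop) (h : W → ℝ), ∑ b, (if p then h b else 0) =
      if p then ∑ b, h b else 0 := by
    intro p h
    split_ifs <;> simp
  have hsum : ∀ c, ∑ b, (if b = c then g b else 0) = g c := fun c => by simp
  simp only [hite, Finset.sum_ite_mem, Finset.univ_inter]
  split_ifs <;> (try simp only [hsum]) <;> ring

open scoped Classical in
theorem Shiftable.vdeg (hS : Shiftable H v u S) (a : W) :
    vdeg (shiftEdges H v u S) a + (if a = v then S.card else 0) =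
      vdeg H a + (if a = u then S.card else 0) := by
  have h := hS.nsum (fun _ => 1) a
  simp only [nsum_one, Finset.sum_const, nsmul_eq_mul, mul_one, sub_self, ite_self, add_zero] at h
  have h2 : ((_root_.vdeg (shiftEdges H v u S) a + (if a = v then S.card else 0) : ℕ) : ℝ) =
      ((_root_.vdeg H a + (if a = u then S.card else 0) : ℕ) : ℝ) := by
    push_cast
    linarith
  exact_mod_cast h2

open scoped Classical in
theorem Shiftable.vdeg_real (hS : Shiftable H v u S) (a : W) :
    (_root_.vdeg (shiftEdges H v u S) a : ℝ) = _root_.vdeg H a + (if a = u then (S.card : ℝ) else 0)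
      - (if a = v then (S.card : ℝ) else 0) := by
  have h := hS.nsum (fun _ => 1) a
  simpa only [nsum_one, Finset.sum_const, nsmul_eq_mul, mul_one, sub_self, ite_self, add_zero]
    using h

theorem Shiftable.mrow_target (hS : Shiftable H v u S) (α : ℝ) (g : W → ℝ) :
    mrow (shiftEdges H v u S) α g u = mrow H α g u + ∑ s ∈ S, g s + α * S.card * g u := by
  classical
  have huS : u ∉ S := fun h => hS.ne_target u h rfl
  simp only [mrow, hS.nsum, hS.vdeg_real, if_true, if_neg hS.ne, if_neg huS]
  ring

theorem Shiftable.mrow_mem (hS : Shiftable H v u S) (α : ℝ) (g : W → ℝ) {s : W} (hs : s ∈ S) :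
    mrow (shiftEdges H v u S) α g s = mrow H α g s + (g u - g v) := by
  classical
  simp only [mrow, hS.nsum, hS.vdeg_real, if_neg (hS.ne_target s hs), if_neg (hS.adj s hs).ne',
    if_pos hs]
  ring

theorem Shiftable.mrow_other (hS : Shiftable H v u S) (α : ℝ) (g : W → ℝ) {s : W} (hs : s ∉ S)
    (hu : s ≠ u) (hv : s ≠ v) :
    mrow (shiftEdges H v u S) α g s = mrow H α g s := by
  classical
  simp only [mrow, hS.nsum, hS.vdeg_real, if_neg hs, if_neg hu, if_neg hv]
  ring

theorem Shiftable.quadForm (hS : Shiftable H v u S) (α : ℝ) (g : W → ℝ) :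
    quadForm (shiftEdges H v u S) α g = quadForm H α g + 2 * (g u - g v) * ∑ s ∈ S, g s +
      α * S.card * (g u ^ 2 - g v ^ 2) := by
  classical
  have h : ∀ a, g a * mrow (shiftEdges H v u S) α g a = g a * mrow H α g a +
      (if a = u then g a * (∑ s ∈ S, g s + α * S.card * g a) else 0) -
      (if a = v then g a * (∑ s ∈ S, g s + α * S.card * g a) else 0) +
      (if a ∈ S then g a * (g u - g v) else 0) := by
    intro a
    simp only [mrow, hS.nsum, hS.vdeg_real]
    split_ifs <;> ring
  unfold _root_.quadForm
  simp only [h, Finset.sum_add_distrib, Finset.sum_sub_distrib, Finset.sum_ite_eq',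
    Finset.mem_univ, if_true, Finset.sum_ite_mem, Finset.univ_inter, ← Finset.sum_mul]
  ring

end Shift

/-! ### Replacing two edges -/

/-- The edges `vw`, `yx` may be replaced by `yw`, `ux`. -/
structure DoubleMovable {W : Type*} (H : SimpleGraph W) (v w y x u : W) : Prop where
  adj_vw : H.Adj v w
  adj_yx : H.Adj y x
  ne_yv : y ≠ v
  ne_wy : w ≠ y
  not_adj_yw : ¬ H.Adj y w
  ne_uy : u ≠ y
  ne_xu : x ≠ u
  not_adj_ux : ¬ H.Adj u x

/-- The result of replacing the edges `vw`, `yx` by `yw`, `ux`. -/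
def doubleMove {W : Type*} (H : SimpleGraph W) (v w y x u : W) : SimpleGraph W :=
  shiftEdges (shiftEdges H v y {w}) y u {x}

namespace DoubleMovable

variable {W : Type*} {H : SimpleGraph W} {v w y x u : W}

theorem ne_xw (h : DoubleMovable H v w y x u) : x ≠ w := fun e =>
  h.not_adj_yw (e ▸ h.adj_yx)

theorem shiftable₁ (h : DoubleMovable H v w y x u) : Shiftable H v y {w} where
  ne := h.ne_yv
  adj := by simpa using h.adj_vw
  ne_target := by simpa using h.ne_wy
  not_adj := by simpa using h.not_adj_yw

theorem shiftable₂ (h : DoubleMovable H v w y x u) :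
    Shiftable (shiftEdges H v y {w}) y u {x} where
  ne := h.ne_uy
  adj := by
    simp only [Finset.mem_singleton, forall_eq]
    refine shiftEdges_adj_of_adj h.adj_yx (fun e => h.ne_yv e.1) fun e => ?_
    simp only [Finset.mem_singleton] at e
    exact h.ne_wy e.2.symm
  ne_target := by simpa using h.ne_xu
  not_adj := by
    simp only [Finset.mem_singleton, forall_eq]
    rintro ⟨-, h1 | h1 | h1⟩
    · exact h.not_adj_ux h1.1
    · exact h.ne_uy h1.1
    · exact h.adj_yx.ne h1.1.symm

theorem adj_of_adj (_h : DoubleMovable H v w y x u) {a b : W} (hab : H.Adj a b)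
    (h1 : ¬ (a = v ∧ b = w)) (h2 : ¬ (b = v ∧ a = w)) (h3 : ¬ (a = y ∧ b = x))
    (h4 : ¬ (b = y ∧ a = x)) : (doubleMove H v w y x u).Adj a b :=
  shiftEdges_adj_of_adj (shiftEdges_adj_of_adj hab (by simpa using h1) (by simpa using h2))
    (by simpa using h3) (by simpa using h4)

theorem adj_ux (h : DoubleMovable H v w y x u) : (doubleMove H v w y x u).Adj u x :=
  h.shiftable₂.adj_new (by simp)

theorem adj_yw (h : DoubleMovable H v w y x u) : (doubleMove H v w y x u).Adj y w := by
  refine shiftEdges_adj_of_adj (h.shiftable₁.adj_new (by simp)) ?_ ?_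
  · simpa using h.ne_xw.symm
  · exact fun e => h.ne_wy e.1

theorem connected (h : DoubleMovable H v w y x u) (hH : H.Connected)
    (h1 : (doubleMove H v w y x u).Reachable v w)
    (h2 : (doubleMove H v w y x u).Reachable y x) : (doubleMove H v w y x u).Connected := by
  refine hH.of_adj_reachable fun a b hab => ?_
  by_cases e1 : a = v ∧ b = w
  · rw [e1.1, e1.2]; exact h1
  by_cases e2 : b = v ∧ a = w
  · rw [e2.1, e2.2]; exact h1.symm
  by_cases e3 : a = y ∧ b = x
  · rw [e3.1, e3.2]; exact h2
  by_cases e4 : b = y ∧ a = x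
  · rw [e4.1, e4.2]; exact h2.symm
  exact (h.adj_of_adj hab e1 e2 e3 e4).reachable

variable [Fintype W]

open scoped Classical in
theorem vdeg (h : DoubleMovable H v w y x u) (a : W) :
    vdeg (doubleMove H v w y x u) a + (if a = v then 1 else 0) =
      vdeg H a + (if a = u then 1 else 0) := by
  have h1 := h.shiftable₁.vdeg a
  have h2 := h.shiftable₂.vdeg a
  simp only [Finset.card_singleton] at h1 h2
  rw [doubleMove]
  omega

/-- The vertex `y` gains `w` and loses `x`, so only `u` and `v` contribute to the `α` term. With `u
= v` the move preserves all degrees. -/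
theorem quadForm (h : DoubleMovable H v w y x u) (α : ℝ) (g : W → ℝ) :
    quadForm (doubleMove H v w y x u) α g = quadForm H α g +
      2 * (g x * (g u - g v) + (g w - g x) * (g y - g v)) + α * (g u ^ 2 - g v ^ 2) := by
  rw [doubleMove, h.shiftable₂.quadForm, h.shiftable₁.quadForm]
  simp only [Finset.sum_singleton, Finset.card_singleton, Nat.cast_one]
  ring

/-- The row at `u` gains `g x + α * g u`. If `u = w`, it also exchanges the neighbour `v` for `y`,
whence the hypothesis `hw`. -/
theorem mrow_target_lt (h : DoubleMovable H v w y x u) (huv : u ≠ v) {α : ℝ} (hα : 0 ≤ α)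
    {g : W → ℝ} (hg : ∀ a, 0 < g a) (hw : u = w → g v ≤ g y) :
    mrow H α g u < mrow (doubleMove H v w y x u) α g u := by
  rw [doubleMove, h.shiftable₂.mrow_target]
  simp only [Finset.sum_singleton, Finset.card_singleton, Nat.cast_one, mul_one]
  have h1 := hg x
  have h2 := mul_nonneg hα (hg u).le
  by_cases e : u = w
  · rw [h.shiftable₁.mrow_mem α g (s := u) (by simpa using e)]
    have := hw e
    linarith
  · rw [h.shiftable₁.mrow_other α g (s := u) (by simpa using e) h.ne_uy huv]
    linarith

end DoubleMovable

/-! ### Extremal weights -/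

/-- `f` is a positive weight for which the bicyclic graph `H` maximizes the quadratic form among all
bicyclic graphs with the same degrees. -/
structure IsExtremalWeight {W : Type*} [Fintype W] (H : SimpleGraph W) (α : ℝ) (f : W → ℝ) :
    Prop where
  alpha_nonneg : 0 ≤ α
  pos : ∀ x, 0 < f x
  cyclic : IsCyclicGraph 2 H
  max : ∀ H₂ : SimpleGraph W, IsCyclicGraph 2 H₂ →
    (∃ σ : Equiv.Perm W, ∀ z, vdeg H₂ (σ z) = vdeg H z) → quadForm H₂ α f ≤ quadForm H α f

open scoped Classical in
/-- A unit of degree can be moved from a vertex of degree `b` to a vertex of degree `a` without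
decreasing the quadratic form. -/
def Improvable {W : Type*} [Fintype W] (H : SimpleGraph W) (α : ℝ) (f : W → ℝ) (a b : ℕ) : Prop :=
  ∃ (u v : W) (H₂ : SimpleGraph W), u ≠ v ∧ vdeg H u = a ∧ vdeg H v = b ∧ IsCyclicGraph 2 H₂ ∧
    (∀ z, vdeg H₂ z + (if z = v then 1 else 0) = vdeg H z + (if z = u then 1 else 0)) ∧
    quadForm H α f ≤ quadForm H₂ α f ∧ ∃ z, mrow H α f z < mrow H₂ α f z

/-- A second neighbour of `v`, together with the nesting, keeps `v`, `u` and `w` connected without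
the edge `vw`; then `y` reaches `x` through `w` and `u'`. The choice `u' = v` is the
degree-preserving switch. -/
theorem DoubleMovable.connected_of_adj {W : Type*} {H : SimpleGraph W} {v w y x u u' : W} (h : DoubleMovable H v w y x u')
    (hH : H.Connected) (huv : u ≠ v) (hdeg : 2 ≤ _root_.vdeg H v)
    (hN : ∀ c, H.Adj v c → c ≠ u → H.Adj u c) (hyu : y ≠ u) (hxu : x ≠ u) (hxv : x ≠ v)
    (hu' : u' = u ∨ u' = v) : (doubleMove H v w y x u').Connected := by
  have hyv := h.ne_yv
  have hvadj : ∀ c, H.Adj v c → c ≠ w → (doubleMove H v w y x u').Adj v c := fun c hc hcw =>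
    h.adj_of_adj hc (fun e => hcw e.2) (fun e => hc.ne e.1.symm) (fun e => hyv e.1.symm)
      (fun e => hxv e.2.symm)
  have huadj : ∀ c, H.Adj u c → c ≠ v → (doubleMove H v w y x u').Adj u c := fun c hc hcv =>
    h.adj_of_adj hc (fun e => huv e.1) (fun e => hcv e.1) (fun e => hyu e.1.symm)
      (fun e => hxu e.2.symm)
  have key : (doubleMove H v w y x u').Reachable v u ∧
      (doubleMove H v w y x u').Reachable v w := by
    obtain ⟨c, hc, hcw⟩ := exists_adj_ne_of_two_le_vdeg hdeg w
    by_cases hwu : w = u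
    · subst hwu
      have := (hvadj c hc hcw).reachable.trans (huadj c (hN c hc hcw) hc.ne').symm.reachable
      exact ⟨this, this⟩
    · have h1 := (huadj w (hN w h.adj_vw hwu) h.adj_vw.ne').reachable
      have h2 : (doubleMove H v w y x u').Reachable v u := by
        by_cases hcu : c = u
        · subst hcu
          exact (hvadj c hc hcw).reachable
        · exact (hvadj c hc hcw).reachable.trans (huadj c (hN c hc hcu) hc.ne').symm.reachable
      exact ⟨h2, h2.trans h1⟩
  refine h.connected hH key.2 ?_
  refine h.adj_yw.reachable.trans (key.2.symm.trans (SimpleGraph.Reachable.trans ?_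
    h.adj_ux.reachable))
  rcases hu' with rfl | rfl
  · exact key.1
  · exact SimpleGraph.Reachable.refl _

section Extremal

variable {W : Type*} [Fintype W] {H : SimpleGraph W} {α : ℝ} {f : W → ℝ}

open scoped Classical in
theorem vdeg_eq_card (H : SimpleGraph W) (x : W) :
    vdeg H x = (Finset.univ.filter (H.Adj x)).card := by
  rw [vdeg, Set.ncard_eq_toFinset_card']
  congr 1
  ext y
  simp

open scoped Classical in
theorem IsCyclicGraph.of_vdeg {c : ℕ} (hH : IsCyclicGraph c H) {H₂ : SimpleGraph W}
    (hc : H₂.Connected) {u v : W} {m : ℕ}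
    (hd : ∀ z, vdeg H₂ z + (if z = v then m else 0) = vdeg H z + (if z = u then m else 0)) :
    IsCyclicGraph c H₂ := by
  rw [isCyclicGraph_iff] at hH ⊢
  refine ⟨hc, ?_⟩
  have h := Finset.sum_congr (s₁ := (Finset.univ : Finset W)) rfl fun z _ => hd z
  simp only [Finset.sum_add_distrib, Finset.sum_ite_eq', Finset.mem_univ, if_true] at h
  omega

theorem IsExtremalWeight.connected (hE : IsExtremalWeight H α f) : H.Connected := hE.cyclic.1

/-- Otherwise moving `vdeg H x - vdeg H y` neighbours of `x` to `y` interchanges the two degrees and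
strictly increases the form. -/
theorem IsExtremalWeight.le_of_vdeg_lt (hE : IsExtremalWeight H α f) {x y : W}
    (hlt : vdeg H y < vdeg H x) : f y ≤ f x := by
  classical
  by_contra hf
  rw [not_le] at hf
  have hxy : x ≠ y := fun e => by rw [e] at hlt; exact lt_irrefl _ hlt
  have hconn := hE.connected
  obtain ⟨p, hp, hpd⟩ := hconn.exists_adj_dist_add_one y hxy
  set T := (Finset.univ.filter (H.Adj x)).filter fun z => z ≠ y ∧ ¬ H.Adj y z ∧ z ≠ p with hT
  set R := (Finset.univ.filter (H.Adj x)).filter fun z => ¬ (z ≠ y ∧ ¬ H.Adj y z ∧ z ≠ p) with hR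
  have hsum : T.card + R.card = vdeg H x := by
    rw [vdeg_eq_card, hT, hR]
    exact Finset.card_filter_add_card_filter_not _
  -- `R` holds the neighbours of `x` that cannot be moved: `y`, common neighbours, and `p`, kept for
  -- connectivity. If `x` and `y` are adjacent, then `p = y`, and trading `y` for `x` compares `R`
  -- with the neighbours of `y`. At distance two all of `R` is adjacent to `y`. At larger distance
  -- only `p` is left.
  have hRcard : R.card ≤ vdeg H y := by
    rw [vdeg_eq_card]
    by_cases hadj : H.Adj y x
    · have hpy : p = y := by
        rw [SimpleGraph.dist_eq_one_iff_adj.2 hadj] at hpd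
        have h0 : H.dist y p = 0 := by omega
        exact (hconn.dist_eq_zero_iff.1 h0).symm
      have hsub : R ⊆ insert y ((Finset.univ.filter (H.Adj y)).erase x) := by
        intro z hz
        simp only [hR, Finset.mem_filter, Finset.mem_univ, true_and, hpy] at hz
        simp only [Finset.mem_insert, Finset.mem_erase, Finset.mem_filter, Finset.mem_univ,
          true_and]
        have := hz.1.ne'
        tauto
      refine (Finset.card_le_card hsub).trans ((Finset.card_insert_le _ _).trans ?_)
      rw [Finset.card_erase_add_one]
      simpa using hadj
    · by_cases hyp : H.Adj y p
      · refine Finset.card_le_card fun z hz => ?_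
        simp only [hR, Finset.mem_filter, Finset.mem_univ, true_and] at hz ⊢
        by_contra hyz
        by_cases hzy : z = y
        · exact hadj (hzy ▸ hz.1.symm)
        · by_cases hzp : z = p
          · exact hyz (hzp ▸ hyp)
          · exact hz.2 ⟨hzy, hyz, hzp⟩
      · have hsub : R ⊆ {p} := by
          intro z hz
          simp only [hR, Finset.mem_filter, Finset.mem_univ, true_and] at hz
          rw [Finset.mem_singleton]
          by_contra hzp
          have hzy : z ≠ y := fun e => hadj (e ▸ hz.1.symm)
          have hyz : H.Adj y z := by
            by_contra hyz
            exact hz.2 ⟨hzy, hyz, hzp⟩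
          have h2 : H.dist y x ≤ H.dist y z + H.dist z x := hconn.dist_triangle
          rw [SimpleGraph.dist_eq_one_iff_adj.2 hyz,
            SimpleGraph.dist_eq_one_iff_adj.2 hz.1.symm] at h2
          have h3 : H.dist y p ≠ 1 := fun e => hyp (SimpleGraph.dist_eq_one_iff_adj.1 e)
          have h4 : H.dist y p = 0 := by omega
          exact hadj ((hconn.dist_eq_zero_iff.1 h4) ▸ hp.symm)
        refine (Finset.card_le_card hsub).trans ?_
        rw [Finset.card_singleton, ← vdeg_eq_card]
        obtain ⟨q, hq, -⟩ := hconn.exists_adj_dist_add_one x hxy.symm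
        exact vdeg_pos_of_adj hq
  obtain ⟨S, hST, hScard⟩ := Finset.exists_subset_card_eq
    (show vdeg H x - vdeg H y ≤ T.card by omega)
  have hmem : ∀ s ∈ S, H.Adj x s ∧ s ≠ y ∧ ¬ H.Adj y s ∧ s ≠ p := by
    intro s hs
    have := hST hs
    simpa [hT] using this
  have hS : Shiftable H x y S :=
    ⟨hxy.symm, fun s hs => (hmem s hs).1, fun s hs => (hmem s hs).2.1,
      fun s hs => (hmem s hs).2.2.1⟩
  have hc : (shiftEdges H x y S).Connected :=
    hS.connected hconn hp (fun h => (hmem p h).2.2.2 rfl) (by omega)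
  have hcyc := hE.cyclic.of_vdeg hc hS.vdeg
  have hmax := hE.max _ hcyc ⟨Equiv.swap x y, fun z => by
    have h1 := hS.vdeg (Equiv.swap x y z)
    rcases eq_or_ne z x with rfl | hzx
    · rw [Equiv.swap_apply_left] at h1 ⊢
      rw [if_neg hxy.symm, if_pos rfl] at h1
      omega
    rcases eq_or_ne z y with rfl | hzy
    · rw [Equiv.swap_apply_right] at h1 ⊢
      rw [if_pos rfl, if_neg hxy] at h1
      omega
    · rw [Equiv.swap_apply_of_ne_of_ne hzx hzy] at h1 ⊢
      rw [if_neg hzx, if_neg hzy] at h1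
      omega⟩
  rw [hS.quadForm] at hmax
  have hSne : S.Nonempty := by
    rw [← Finset.card_pos]
    omega
  have h1 : 0 < ∑ s ∈ S, f s := Finset.sum_pos (fun s _ => hE.pos s) hSne
  have h2 : 0 < f y - f x := by linarith
  have h3 := mul_pos h2 h1
  have h4 : 0 ≤ α * S.card * (f y ^ 2 - f x ^ 2) := by
    refine mul_nonneg (mul_nonneg hE.alpha_nonneg (Nat.cast_nonneg _)) ?_
    have := hE.pos x
    nlinarith
  nlinarith

theorem IsExtremalWeight.improvable_of_shift (hE : IsExtremalWeight H α f) {u v w p : W}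
    (huv : u ≠ v) (hf : f v ≤ f u) (hw : H.Adj v w) (hwu : w ≠ u) (huw : ¬ H.Adj u w)
    (hp : H.Adj v p) (hpw : p ≠ w) (hd : H.dist u p < H.dist u v) :
    Improvable H α f (vdeg H u) (vdeg H v) := by
  have hS : Shiftable H v u {w} := ⟨huv, by simpa using hw, by simpa using hwu, by simpa using huw⟩
  have hc := hS.connected hE.connected hp (by simpa using hpw) hd
  have hdeg := hS.vdeg
  rw [Finset.card_singleton] at hdeg
  refine ⟨u, v, _, huv, rfl, rfl, hE.cyclic.of_vdeg hc hdeg, hdeg, ?_, u, ?_⟩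
  · rw [hS.quadForm]
    simp only [Finset.sum_singleton, Finset.card_singleton, Nat.cast_one, mul_one]
    have h1 : 0 ≤ 2 * (f u - f v) * f w := mul_nonneg (by linarith) (hE.pos w).le
    have h2 : 0 ≤ α * (f u ^ 2 - f v ^ 2) := by
      refine mul_nonneg hE.alpha_nonneg ?_
      have := hE.pos v
      nlinarith
    linarith
  · rw [hS.mrow_target]
    simp only [Finset.sum_singleton, Finset.card_singleton, Nat.cast_one, mul_one]
    have h1 := hE.pos w
    have h2 := mul_nonneg hE.alpha_nonneg (hE.pos u).le
    linarith

theorem IsExtremalWeight.adj_of_not_improvable (hE : IsExtremalWeight H α f) {u v : W}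
    (hI : ¬ Improvable H α f (vdeg H u) (vdeg H v)) (huv : u ≠ v) (hf : f v ≤ f u)
    (h2 : 2 ≤ vdeg H v) {w : W} (hw : H.Adj v w) (hwu : w ≠ u) : H.Adj u w := by
  by_contra huw
  have hconn := hE.connected
  obtain ⟨p, hp, hpd⟩ := hconn.exists_adj_dist_add_one u huv.symm
  -- If `w` is the only link chosen towards `u`, it is kept and another neighbour `q` of `v` moves:
  -- here `v` is at distance at least three from `u`, so `q` is not adjacent to `u`.
  by_cases hpw : p = w
  · subst hpw
    obtain ⟨q, hq, hqp⟩ := exists_adj_ne_of_two_le_vdeg h2 p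
    have hpu : H.dist u p ≠ 0 := fun e => hwu ((hconn.dist_eq_zero_iff.1 e).symm)
    have hp1 : H.dist u p ≠ 1 := fun e => huw (SimpleGraph.dist_eq_one_iff_adj.1 e)
    have hqu : q ≠ u := by
      rintro rfl
      have := SimpleGraph.dist_eq_one_iff_adj.2 hq.symm
      omega
    have huq : ¬ H.Adj u q := by
      intro h
      have h3 : H.dist u v ≤ H.dist u q + H.dist q v := hconn.dist_triangle
      rw [SimpleGraph.dist_eq_one_iff_adj.2 h, SimpleGraph.dist_eq_one_iff_adj.2 hq.symm] at h3
      omega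
    exact hI (hE.improvable_of_shift huv hf hq hqu huq hp hqp.symm (by omega))
  · exact hI (hE.improvable_of_shift huv hf hw hwu huw hp hpw (by omega))

theorem IsExtremalWeight.improvable_of_doubleMove (hE : IsExtremalWeight H α f) {v w y x u : W}
    (h : DoubleMovable H v w y x u) (huv : u ≠ v) (hf : f v ≤ f u)
    (hc : (doubleMove H v w y x u).Connected)
    (hq : 0 ≤ f x * (f u - f v) + (f w - f x) * (f y - f v)) (hw : u = w → f v ≤ f y) :
    Improvable H α f (vdeg H u) (vdeg H v) := by
  refine ⟨u, v, _, huv, rfl, rfl, hE.cyclic.of_vdeg hc h.vdeg, h.vdeg, ?_, u,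
    h.mrow_target_lt huv hE.alpha_nonneg hE.pos hw⟩
  rw [h.quadForm]
  have h2 : 0 ≤ α * (f u ^ 2 - f v ^ 2) := by
    refine mul_nonneg hE.alpha_nonneg ?_
    have := hE.pos v
    nlinarith
  linarith

/-- With target `v` the double move changes no degree, so extremality forbids a gain. -/
theorem IsExtremalWeight.switch_nonpos (hE : IsExtremalWeight H α f) {v w y x : W}
    (h : DoubleMovable H v w y x v) (hc : (doubleMove H v w y x v).Connected) :
    (f w - f x) * (f y - f v) ≤ 0 := by
  have hmax := hE.max _ (hE.cyclic.of_vdeg hc h.vdeg) ⟨Equiv.refl W, fun z => by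
    have := h.vdeg z
    rw [Equiv.refl_apply]
    omega⟩
  rw [h.quadForm] at hmax
  nlinarith

end Extremal

/-! ### Sparsity of bicyclic graphs -/

/-- Outside of `K`, the graph `H` is a forest growing out of `K`: every vertex outside of `K` has a
parent, and its other neighbours lie outside of `K` and are farther away from `u`. -/
def IsTightCore {W : Type*} (H : SimpleGraph W) (u : W) (K : Finset W) : Prop :=
  ∀ x ∉ K, ∃ p, H.Adj x p ∧ ∀ y, H.Adj x y → y ≠ p → y ∉ K ∧ H.dist u y = H.dist u x + 1

section Sparsity

variable {W : Type*} [Fintype W] {H : SimpleGraph W}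

/-- Each vertex outside `K` chooses an edge to a neighbour nearer to `u`. These edges are distinct
and not in `F`, while `H` has one edge more than vertices. In the equality case every edge is in `F`
or is one of the chosen edges. -/
theorem IsCyclicGraph.card_le_and_isTightCore (hH : IsCyclicGraph 2 H) {u : W} {K : Finset W}
    (hu : u ∈ K) (F : Finset (Sym2 W)) (hF : ∀ e ∈ F, e ∈ H.edgeSet)
    (hFK : ∀ e ∈ F, ∀ x ∈ e, x ∈ K) :
    F.card ≤ K.card + 1 ∧ (K.card + 1 ≤ F.card → IsTightCore H u K) := by
  classical
  have hex : ∀ x, ∃ p, x ∉ K → H.Adj x p ∧ H.dist u p + 1 = H.dist u x := by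
    intro x
    by_cases hx : x ∈ K
    · exact ⟨x, fun h => absurd hx h⟩
    · obtain ⟨p, hp⟩ := hH.1.exists_adj_dist_add_one u (x := x) (by rintro rfl; exact hx hu)
      exact ⟨p, fun _ => hp⟩
  choose P hP using hex
  set T : Finset (Sym2 W) := Kᶜ.image fun x => s(x, P x) with hT
  have hTcard : T.card = Fintype.card W - K.card := by
    rw [hT, Finset.card_image_of_injOn, Finset.card_compl]
    intro x hx y hy hxy
    have hx' : x ∉ K := by simpa using hx
    have hy' : y ∉ K := by simpa using hy
    simp only [Sym2.eq_iff] at hxy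
    rcases hxy with h | h
    · exact h.1
    · have h1 := (hP x hx').2
      have h2 := (hP y hy').2
      rw [h.2] at h1
      rw [← h.1] at h2
      omega
  have hdisj : Disjoint F T := by
    rw [Finset.disjoint_left]
    intro e he heT
    simp only [hT, Finset.mem_image, Finset.mem_compl] at heT
    obtain ⟨x, hx, rfl⟩ := heT
    exact hx (hFK _ he x (Sym2.mem_mk_left _ _))
  have hsub : F ∪ T ⊆ H.edgeFinset := by
    intro e he
    rw [SimpleGraph.mem_edgeFinset]
    rcases Finset.mem_union.1 he with h | h
    · exact hF e h
    · simp only [hT, Finset.mem_image, Finset.mem_compl] at h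
      obtain ⟨x, hx, rfl⟩ := h
      exact (hP x hx).1
  have hE : H.edgeFinset.card + 1 = Fintype.card W + 2 := by
    have h := hH.2
    rw [Set.ncard_eq_toFinset_card', Nat.card_eq_fintype_card] at h
    exact h
  have hKW : K.card ≤ Fintype.card W := Finset.card_le_univ K
  have hle := Finset.card_le_card hsub
  rw [Finset.card_union_of_disjoint hdisj] at hle
  refine ⟨by omega, fun htight x hx => ⟨P x, (hP x hx).1, fun y hy hyP => ?_⟩⟩
  have heq : F ∪ T = H.edgeFinset := Finset.eq_of_subset_of_card_le hsub (by
    rw [Finset.card_union_of_disjoint hdisj]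
    omega)
  have hmem : s(x, y) ∈ F ∪ T := by
    rw [heq, SimpleGraph.mem_edgeFinset]
    exact hy
  rcases Finset.mem_union.1 hmem with h | h
  · exact absurd (hFK _ h x (Sym2.mem_mk_left _ _)) hx
  · simp only [hT, Finset.mem_image, Finset.mem_compl] at h
    obtain ⟨z, hz, hzxy⟩ := h
    rcases Sym2.eq_iff.1 hzxy with ⟨rfl, h2⟩ | ⟨rfl, h2⟩
    · exact absurd h2.symm hyP
    · refine ⟨hz, ?_⟩
      have := (hP z hz).2
      rw [h2] at this
      exact this.symm

theorem IsCyclicGraph.length_le_and_isTightCore (hH : IsCyclicGraph 2 H) {u : W} {K : Finset W}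
    (hu : u ∈ K) (l : List (W × W)) (hl : ∀ e ∈ l, H.Adj e.1 e.2 ∧ e.1 ∈ K ∧ e.2 ∈ K)
    (hnd : (l.map fun e => s(e.1, e.2)).Nodup) :
    l.length ≤ K.card + 1 ∧ (K.card + 1 ≤ l.length → IsTightCore H u K) := by
  classical
  have h := hH.card_le_and_isTightCore hu (l.map fun e => s(e.1, e.2)).toFinset
    (by
      intro e he
      simp only [List.mem_toFinset, List.mem_map] at he
      obtain ⟨p, hp, rfl⟩ := he
      exact (hl p hp).1)
    (by
      intro e he x hx
      simp only [List.mem_toFinset, List.mem_map] at he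
      obtain ⟨p, hp, rfl⟩ := he
      rcases Sym2.mem_iff.1 hx with rfl | rfl
      · exact (hl p hp).2.1
      · exact (hl p hp).2.2)
  rwa [List.toFinset_card_of_nodup hnd, List.length_map] at h

/-- In a bicyclic graph a set of `k` vertices spans at most `k + 1` edges. -/
theorem IsCyclicGraph.length_le (hH : IsCyclicGraph 2 H) {K : Finset W}
    (l : List (W × W)) (hl : ∀ e ∈ l, H.Adj e.1 e.2 ∧ e.1 ∈ K ∧ e.2 ∈ K)
    (hnd : (l.map fun e => s(e.1, e.2)).Nodup) : l.length ≤ K.card + 1 := by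
  rcases K.eq_empty_or_nonempty with rfl | ⟨u, hu⟩
  · cases l with
    | nil => simp
    | cons e l => simpa using (hl e (by simp)).2.1
  · exact (hH.length_le_and_isTightCore hu l hl hnd).1

end Sparsity

section TightCore

variable {W : Type*} {H : SimpleGraph W}

theorem IsTightCore.eq_of_adj {u x p q : W} {K : Finset W} (hK : IsTightCore H u K) (hx : x ∉ K)
    (hp : H.Adj x p) (hpK : p ∈ K) (hq : H.Adj x q) (hqK : q ∈ K) : p = q := by
  obtain ⟨r, -, hr⟩ := hK x hx
  by_contra hpq
  by_cases h : p = r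
  · exact (hr q hq (fun e => hpq (h.trans e.symm))).1 hqK
  · exact (hr p hp h).1 hpK

/-- The neighbour of `x ∉ K` which is closer to the root is the parent. -/
theorem IsTightCore.of_dist_lt {u x y : W} {K : Finset W} (hK : IsTightCore H u K) (hx : x ∉ K)
    (hy : H.Adj x y) (hd : y ∈ K ∨ H.dist u y ≤ H.dist u x) {z : W} (hz : H.Adj x z)
    (hzy : z ≠ y) : z ∉ K ∧ H.dist u z = H.dist u x + 1 := by
  obtain ⟨r, -, hr⟩ := hK x hx
  have : y = r := by
    by_contra h
    have := hr y hy h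
    rcases hd with hd | hd
    · exact this.1 hd
    · omega
  exact hr z hz (this ▸ hzy)

end TightCore

/-! ### Small dense subgraphs -/

section Dense

variable {W : Type*} [Fintype W] {H : SimpleGraph W} {p q r s t x : W}

/-- Seven edges on five vertices exceed the sparsity bound by one; the next three lemmas are the
same count for other small graphs. -/
theorem IsCyclicGraph.not_three_common_of_adj (hH : IsCyclicGraph 2 H) (hpq : H.Adj p q)
    (hpr : H.Adj p r) (hqr : H.Adj q r) (hps : H.Adj p s) (hqs : H.Adj q s)
    (hpt : H.Adj p t) (hqt : H.Adj q t) (hrs : r ≠ s) (hrt : r ≠ t) (hst : s ≠ t) : False := by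
  classical
  have h := hH.length_le (K := {p, q, r, s, t})
    [(p, q), (p, r), (q, r), (p, s), (q, s), (p, t), (q, t)]
    (by simp [hpq, hpr, hqr, hps, hqs, hpt, hqt])
    (by simp [hrs, hrt, hst, hpq.ne, hpr.ne, hqr.ne, hps.ne, hqs.ne, hpt.ne, hqt.ne, hpq.ne',
      hpr.ne', hps.ne'])
  have h5 := Finset.card_le_five (a := p) (b := q) (c := r) (d := s) (e := t)
  simp only [List.length_cons, List.length_nil] at h
  omega

theorem IsCyclicGraph.not_four_common (hH : IsCyclicGraph 2 H)
    (hpr : H.Adj p r) (hqr : H.Adj q r) (hps : H.Adj p s) (hqs : H.Adj q s)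
    (hpt : H.Adj p t) (hqt : H.Adj q t) (hpx : H.Adj p x) (hqx : H.Adj q x) (hpq : p ≠ q)
    (hrs : r ≠ s) (hrt : r ≠ t) (hst : s ≠ t) (hxr : x ≠ r) (hxs : x ≠ s) (hxt : x ≠ t) :
    False := by
  classical
  have h := hH.length_le (K := {p, q, r, s, t, x})
    [(p, r), (q, r), (p, s), (q, s), (p, t), (q, t), (p, x), (q, x)]
    (by simp [hpr, hqr, hps, hqs, hpt, hqt, hpx, hqx])
    (by simp [hpq, hrs, hrt, hst, hxr.symm, hxs.symm, hxt.symm, hpr.ne, hps.ne, hpt.ne,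
      hpr.ne', hps.ne', hpt.ne', hpx.ne, hqr.ne', hqs.ne', hqt.ne'])
  have h6 := Finset.card_le_six (a := p) (b := q) (c := r) (d := s) (e := t) (f := x)
  simp only [List.length_cons, List.length_nil] at h
  omega

theorem IsCyclicGraph.not_adj_of_three_common (hH : IsCyclicGraph 2 H) (hpq : p ≠ q)
    (hpr : H.Adj p r) (hqr : H.Adj q r) (hps : H.Adj p s) (hqs : H.Adj q s)
    (hpt : H.Adj p t) (hqt : H.Adj q t) (hrt : r ≠ t) (hst : s ≠ t) :
    ¬ H.Adj r s := by
  classical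
  intro hrs
  have h := hH.length_le (K := {p, q, r, s, t})
    [(p, r), (q, r), (p, s), (q, s), (p, t), (q, t), (r, s)]
    (by simp [hrs, hpr, hqr, hps, hqs, hpt, hqt])
    (by simp [hpq, hrs.ne, hrt, hst, hpr.ne, hqr.ne, hps.ne, hqs.ne, hpt.ne, hqt.ne, hpr.ne',
      hps.ne'])
  have h5 := Finset.card_le_five (a := p) (b := q) (c := r) (d := s) (e := t)
  simp only [List.length_cons, List.length_nil] at h
  omega

theorem IsCyclicGraph.not_adj_of_diamond (hH : IsCyclicGraph 2 H) (hpq : H.Adj p q)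
    (hpr : H.Adj p r) (hqr : H.Adj q r) (hps : H.Adj p s) (hqs : H.Adj q s) : ¬ H.Adj r s := by
  classical
  intro hrs
  have h := hH.length_le (K := {p, q, r, s})
    [(p, q), (p, r), (q, r), (p, s), (q, s), (r, s)]
    (by simp [hrs, hpq, hpr, hqr, hps, hqs])
    (by simp [hrs.ne, hpq.ne, hpr.ne, hqr.ne, hps.ne, hqs.ne, hpq.ne', hpr.ne'])
  have h4 := Finset.card_le_four (a := p) (b := q) (c := r) (d := s)
  simp only [List.length_cons, List.length_nil] at h
  omega

open scoped Classical in
-- Five edges on four vertices attain the sparsity bound.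
theorem IsCyclicGraph.isTightCore_diamond (hH : IsCyclicGraph 2 H) (hpq : H.Adj p q)
    (hpr : H.Adj p r) (hqr : H.Adj q r) (hps : H.Adj p s) (hqs : H.Adj q s) (hrs : r ≠ s)
    (hx : x ∈ ({p, q, r, s} : Finset W)) : IsTightCore H x {p, q, r, s} := by
  have h := hH.length_le_and_isTightCore hx
    [(p, q), (p, r), (q, r), (p, s), (q, s)]
    (by simp [hpq, hpr, hqr, hps, hqs])
    (by simp [hrs, hpq.ne, hpr.ne, hqr.ne, hps.ne, hqs.ne, hpq.ne', hpr.ne'])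
  refine h.2 ?_
  have h4 := Finset.card_le_four (a := p) (b := q) (c := r) (d := s)
  simp only [List.length_cons, List.length_nil]
  omega

end Dense

/-! ### Nested neighbourhoods -/

/-- The neighbourhood of a vertex of degree `b` is contained in the closed neighbourhood of every
vertex of degree `a` of at least the same weight. -/
def PairsNested {W : Type*} (H : SimpleGraph W) (f : W → ℝ) (a b : ℕ) : Prop :=
  ∀ u v, u ≠ v → vdeg H u = a → vdeg H v = b → f v ≤ f u →
    ∀ w, H.Adj v w → w ≠ u → H.Adj u w

section Nested

variable {W : Type*} [Fintype W] {H : SimpleGraph W} {α : ℝ} {f : W → ℝ} {a b : ℕ}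

theorem IsExtremalWeight.pairsNested (hE : IsExtremalWeight H α f)
    (hI : ¬ Improvable H α f a b) (hb : 2 ≤ b) : PairsNested H f a b := by
  rintro u v huv rfl rfl hf w hw hwu
  exact hE.adj_of_not_improvable hI huv hf hb hw hwu

/-- Only `vdeg H y = b` needs an argument. If `b < a`, nesting of `y` under `u` is refuted by `x`;
if `a = b` and `y` were lighter than `v`, nesting of `y` under `v` would be refuted by `x'`. -/
theorem IsExtremalWeight.le_of_adj_not_adj (hE : IsExtremalWeight H α f)
    (hN : PairsNested H f a b) (hab : b ≤ a) {u v y x x' : W} (hu : vdeg H u = a)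
    (hv : vdeg H v = b) (hyu : y ≠ u) (hyv : y ≠ v) (hy : b ≤ vdeg H y) (hx : H.Adj y x)
    (hxu : x ≠ u) (hux : ¬ H.Adj u x) (hx' : H.Adj y x') (hxv' : x' ≠ v) (hvx' : ¬ H.Adj v x') :
    f v ≤ f y := by
  rcases hy.lt_or_eq with h | h
  · exact hE.le_of_vdeg_lt (by omega)
  rcases hab.lt_or_eq with h2 | h2
  · exact absurd (hN u y hyu.symm hu h.symm (hE.le_of_vdeg_lt (by omega)) x hx hxu) hux
  · by_contra hf
    exact hvx' (hN v y hyv.symm (hv.trans h2) h.symm (not_le.1 hf).le x' hx' hxv')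

theorem IsExtremalWeight.improvable_of_edge (hE : IsExtremalWeight H α f) {u v w y x : W}
    (huv : u ≠ v) (hf : f v ≤ f u) (hdeg : 2 ≤ vdeg H v)
    (hN : ∀ c, H.Adj v c → c ≠ u → H.Adj u c) (hw : H.Adj v w) (hyx : H.Adj y x) (hyu : y ≠ u)
    (hyv : y ≠ v) (hxu : x ≠ u) (hxv : x ≠ v) (hwy : w ≠ y) (hyw : ¬ H.Adj y w)
    (hux : ¬ H.Adj u x) (hfy : f v ≤ f y) (hfx : f x ≤ f w) :
    Improvable H α f (vdeg H u) (vdeg H v) := by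
  have h : DoubleMovable H v w y x u := ⟨hw, hyx, hyv, hwy, hyw, hyu.symm, hxu, hux⟩
  refine hE.improvable_of_doubleMove h huv hf
    (h.connected_of_adj hE.connected huv hdeg hN hyu hxu hxv (Or.inl rfl)) ?_ fun _ => hfy
  have h1 := mul_nonneg (hE.pos x).le (sub_nonneg.2 hf)
  have h2 := mul_nonneg (sub_nonneg.2 hfx) (sub_nonneg.2 hfy)
  linarith

/-- The double move with `y = w₂`, `x = v`: the edges `vw₁`, `vw₂` are replaced by `w₁w₂`, `uv`, and
the paths through `u` keep the graph connected. -/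
theorem IsExtremalWeight.improvable_of_not_adj (hE : IsExtremalWeight H α f) {u v w₁ w₂ : W}
    (huv : u ≠ v) (hf : f v ≤ f u) (hnadj : ¬ H.Adj u v) (h1 : H.Adj v w₁) (h2 : H.Adj v w₂)
    (hu1 : H.Adj u w₁) (hu2 : H.Adj u w₂) (hne : w₁ ≠ w₂) (h12 : ¬ H.Adj w₁ w₂)
    (hq : 0 ≤ (f w₁ - f v) * (f w₂ - f v)) : Improvable H α f (vdeg H u) (vdeg H v) := by
  have h : DoubleMovable H v w₁ w₂ v u :=
    ⟨h1, h2.symm, h2.ne', hne, fun e => h12 e.symm, hu2.ne, huv.symm, hnadj⟩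
  have ha1 : (doubleMove H v w₁ w₂ v u).Adj u w₁ :=
    h.adj_of_adj hu1 (fun e => huv e.1) (fun e => h1.ne e.1.symm) (fun e => hu2.ne e.1)
      (fun e => hne e.1)
  have ha2 : (doubleMove H v w₁ w₂ v u).Adj u w₂ :=
    h.adj_of_adj hu2 (fun e => huv e.1) (fun e => h2.ne e.1.symm) (fun e => hu2.ne e.1)
      (fun e => huv e.2)
  refine hE.improvable_of_doubleMove h huv hf (h.connected hE.connected ?_ ?_) ?_
    fun e => absurd e hu1.ne
  · exact h.adj_ux.symm.reachable.trans ha1.reachable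
  · exact ha2.symm.reachable.trans h.adj_ux.reachable
  · have := mul_nonneg (hE.pos v).le (sub_nonneg.2 hf)
    linarith

/-- Four neighbours of `v` would produce either adjacent vertices with three common neighbours or a
`K_{2,4}`; both have too many edges. -/
theorem IsCyclicGraph.vdeg_le_three_of_nested (hH : IsCyclicGraph 2 H) {u v : W} (huv : u ≠ v)
    (hN : ∀ c, H.Adj v c → c ≠ u → H.Adj u c) : vdeg H v ≤ 3 := by
  classical
  by_contra hcon
  rw [vdeg_eq_card] at hcon
  set N := Finset.univ.filter (H.Adj v) with hNdef
  have hmem : ∀ c, c ∈ N ↔ H.Adj v c := by simp [hNdef]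
  by_cases hadj : H.Adj v u
  · have hcard : 2 < (N.erase u).card := by
      rw [Finset.card_erase_of_mem ((hmem u).2 hadj)]
      omega
    obtain ⟨r, hr, s, hs, t, ht, hrs, hrt, hst⟩ := Finset.two_lt_card.1 hcard
    simp only [Finset.mem_erase, hmem] at hr hs ht
    exact hH.not_three_common_of_adj hadj hr.2 (hN r hr.2 hr.1) hs.2 (hN s hs.2 hs.1) ht.2
      (hN t ht.2 ht.1) hrs hrt hst
  · obtain ⟨x, hx⟩ : N.Nonempty := Finset.card_pos.1 (by omega)
    have hcard : 2 < (N.erase x).card := by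
      rw [Finset.card_erase_of_mem hx]
      omega
    obtain ⟨r, hr, s, hs, t, ht, hrs, hrt, hst⟩ := Finset.two_lt_card.1 hcard
    simp only [Finset.mem_erase, hmem] at hr hs ht hx
    have hne : ∀ c, H.Adj v c → c ≠ u := fun c hc e => hadj (e ▸ hc)
    exact hH.not_four_common hr.2 (hN r hr.2 (hne r hr.2)) hs.2 (hN s hs.2 (hne s hs.2)) ht.2
      (hN t ht.2 (hne t ht.2)) hx (hN x hx (hne x hx)) huv.symm hrs hrt hst hr.1.symm hs.1.symm
      ht.1.symm

/-- Descending along the forest outside of a tight core, one finds an edge whose lower end has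
weight at most that of `w`, and this edge can be used for an improvement. -/
theorem IsExtremalWeight.improvable_of_descending (hE : IsExtremalWeight H α f) {u v w : W}
    {K : Finset W} (huv : u ≠ v) (hf : f v ≤ f u) (hdeg : 2 ≤ vdeg H v)
    (hN : ∀ c, H.Adj v c → c ≠ u → H.Adj u c) (hK : IsTightCore H u K) (huK : u ∈ K) (hvK : v ∈ K)
    (hNK : ∀ c, H.Adj v c → c ∈ K) (hw : H.Adj v w) (hwdeg : 2 ≤ vdeg H w)
    {y x : W} (hyu : y ≠ u) (hyv : y ≠ v) (hxK : x ∉ K) (hyx : H.Adj y x) (hwy : w ≠ y)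
    (hyw : ¬ H.Adj y w) (hd : H.dist u x = H.dist u y + 1) (hfy : f v ≤ f y) :
    Improvable H α f (vdeg H u) (vdeg H v) := by
  classical
  -- The second alternative in the last condition is what the next edge down satisfies when the
  -- current lower end outweighs `w`.
  set I := Finset.univ.filter fun e : W × W => e.1 ≠ u ∧ e.1 ≠ v ∧ e.2 ∉ K ∧ H.Adj e.1 e.2 ∧
    w ≠ e.1 ∧ ¬ H.Adj e.1 w ∧ H.dist u e.2 = H.dist u e.1 + 1 ∧
    (f v ≤ f e.1 ∨ f w < f e.1 ∧ ¬ H.Adj v e.1) with hI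
  have hne : I.Nonempty :=
    ⟨(y, x), by simp only [hI, Finset.mem_filter, Finset.mem_univ, true_and]
                exact ⟨hyu, hyv, hxK, hyx, hwy, hyw, hd, Or.inl hfy⟩⟩
  obtain ⟨⟨y', x'⟩, hmem, hmax⟩ := I.exists_max_image (fun e => H.dist u e.2) hne
  simp only [hI, Finset.mem_filter, Finset.mem_univ, true_and] at hmem
  obtain ⟨hyu, hyv, hxK, hyx, hwy, hyw, hd, hfy⟩ := hmem
  clear_value I
  have hxu : x' ≠ u := fun e => hxK (e ▸ huK)
  have hxv : x' ≠ v := fun e => hxK (e ▸ hvK)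
  have hvx : ¬ H.Adj v x' := fun e => hxK (hNK _ e)
  have hux : ¬ H.Adj u x' := by
    intro e
    rw [SimpleGraph.dist_eq_one_iff_adj.2 e] at hd
    exact hyu ((hE.connected.dist_eq_zero_iff.1 (show H.dist u y' = 0 by omega)).symm)
  have hchild : ∀ z, H.Adj x' z → z ≠ y' → z ∉ K ∧ H.dist u z = H.dist u x' + 1 :=
    fun z hz hzy => hK.of_dist_lt hxK hyx.symm (Or.inr (by omega)) hz hzy
  have hxw : ¬ H.Adj x' w := fun e => (hchild w e hwy).1 (hNK w hw)
  have hwx : w ≠ x' := fun e => hxK (e ▸ hNK w hw)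
  by_cases hfx : f x' ≤ f w
  · by_cases hvy : f v ≤ f y'
    · exact hE.improvable_of_edge huv hf hdeg hN hw hyx hyu hyv hxu hxv hwy hyw hux hvy hfx
    · exfalso
      -- Now `f x' ≤ f w < f y' < f v`, so the degree-preserving switch of `vw`, `x'y'` would gain a
      -- product of two negative factors.
      obtain ⟨hwy2, hvy2⟩ := hfy.resolve_left hvy
      have h : DoubleMovable H v w x' y' v :=
        ⟨hw, hyx.symm, hxv, hwx, hxw, hxv.symm, hyv, hvy2⟩
      have := hE.switch_nonpos h
        (h.connected_of_adj hE.connected huv hdeg hN hxu hyu hyv (Or.inr rfl))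
      nlinarith
  · exfalso
    rw [not_le] at hfx
    -- Being heavier than `w`, the vertex `x'` is not a leaf, so the edge to a child contradicts the
    -- maximal depth.
    have hx2 : 2 ≤ vdeg H x' := by
      by_contra hlt
      exact absurd (hE.le_of_vdeg_lt (x := w) (y := x') (by omega)) (not_le.2 hfx)
    obtain ⟨z, hz, hzy⟩ := exists_adj_ne_of_two_le_vdeg hx2 y'
    have hzc := hchild z hz hzy
    have := hmax (x', z) (by
      rw [hI, Finset.mem_filter]
      exact ⟨Finset.mem_univ _, hxu, hxv, hzc.1, hz, hwx, hxw, hzc.2, Or.inr ⟨hfx, hvx⟩⟩)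
    simp only at this
    omega

end Nested

/-! ### The lower degree equals three -/

section CaseThree

variable {W : Type*} [Fintype W] {H : SimpleGraph W} {α : ℝ} {f : W → ℝ} {a : ℕ}

theorem exists_adj_ne_ne_of_three_le_vdeg {x : W} (h : 3 ≤ vdeg H x) (p q : W) :
    ∃ y, H.Adj x y ∧ y ≠ p ∧ y ≠ q := by
  by_contra hcon
  push Not at hcon
  have hsub : H.neighborSet x ⊆ {p, q} := by
    intro y hy
    by_cases hyp : y = p
    · exact Or.inl hyp
    · exact Or.inr (hcon y hy hyp)
  have h1 := Set.ncard_le_ncard hsub (Set.toFinite _)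
  have h2 : ({p, q} : Set W).ncard ≤ 2 := by
    have := Set.ncard_insert_le p {q}
    rw [Set.ncard_singleton] at this
    exact this
  unfold vdeg at h
  omega

/-- If all vertices except for two vertices of degree three have degree at most two, then a
bicyclic graph has no tight core other than the whole vertex set. -/
theorem IsCyclicGraph.mem_of_isTightCore (hH : IsCyclicGraph 2 H) {u v : W} {K : Finset W}
    (huv : u ≠ v) (hK : IsTightCore H u K) (huK : u ∈ K) (hvK : v ∈ K) (hu : vdeg H u = 3)
    (hv : vdeg H v = 3) (hle : ∀ z, z ≠ u → z ≠ v → vdeg H z ≤ 2) (x : W) : x ∈ K := by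
  classical
  by_contra hx
  have hne : (Kᶜ : Finset W).Nonempty := ⟨x, by simpa using hx⟩
  obtain ⟨y, hy, hmax⟩ := (Kᶜ : Finset W).exists_max_image (fun z => H.dist u z) hne
  simp only [Finset.mem_compl] at hy hmax
  have hdeg : vdeg H y < 2 := by
    by_contra h
    obtain ⟨p, -, hp⟩ := hK y hy
    obtain ⟨z, hz, hzp⟩ := exists_adj_ne_of_two_le_vdeg (not_lt.1 h) p
    have h1 := hp z hz hzp
    have h2 := hmax z h1.1
    omega
  have hyu : y ≠ u := fun e => hy (e ▸ huK)
  have hyv : y ≠ v := fun e => hy (e ▸ hvK)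
  -- The farthest vertex outside `K` is a leaf. Summation bounds the total degree by one less than
  -- the required `2 * Fintype.card W + 2`.
  have hpt : ∀ z, vdeg H z + (if z = y then 1 else 0) ≤
      2 + (if z = u then 1 else 0) + (if z = v then 1 else 0) := by
    intro z
    rcases eq_or_ne z u with rfl | hzu
    · simp [hu, huv, hyu.symm]
    rcases eq_or_ne z v with rfl | hzv
    · simp [hv, huv.symm, hyv.symm]
    rcases eq_or_ne z y with rfl | hzy
    · simp [hzu, hzv]
      omega
    · simpa [hzu, hzv, hzy] using hle z hzu hzv
  have hsum := Finset.sum_le_sum fun z (_ : z ∈ (Finset.univ : Finset W)) => hpt z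
  simp only [Finset.sum_add_distrib, Finset.sum_ite_eq', Finset.mem_univ, if_true,
    Finset.sum_const, Finset.card_univ, smul_eq_mul] at hsum
  have := ((isCyclicGraph_iff 2 H).1 hH).2
  omega

/-- If `u` and `v` are adjacent, they form a diamond with the other neighbours of `v`; a third
vertex of degree at least three has a child outside it, where the descent starts. If not, they form
a `K_{2,3}`. -/
theorem IsExtremalWeight.improvable_of_three (hE : IsExtremalWeight H α f) (ha : 3 ≤ a)
    (hN : PairsNested H f a 3) (hcard : 5 ≤ Fintype.card W) {u v : W} (huv : u ≠ v)
    (hu : vdeg H u = a) (hv : vdeg H v = 3) (hf : f v ≤ f u)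
    (hz : 4 ≤ a → ∃ z, z ≠ u ∧ z ≠ v ∧ 3 ≤ vdeg H z) : Improvable H α f a 3 := by
  classical
  have hNv := hN u v huv hu hv hf
  rw [← hu, ← hv]
  by_cases hadj : H.Adj u v
  · have hcd : (H.neighborSet v \ {u}).ncard = 2 := by
      rw [Set.ncard_sdiff_singleton_of_mem (show u ∈ H.neighborSet v from hadj.symm)]
      unfold vdeg at hv
      omega
    obtain ⟨w₁, w₂, hw12, hset⟩ := Set.ncard_eq_two.1 hcd
    have hmem : ∀ c, (H.Adj v c ∧ c ≠ u) ↔ (c = w₁ ∨ c = w₂) := fun c => by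
      have := Set.ext_iff.1 hset c
      simpa using this
    have hv1 := (hmem w₁).2 (Or.inl rfl)
    have hv2 := (hmem w₂).2 (Or.inr rfl)
    have hu1 := hNv w₁ hv1.1 hv1.2
    have hu2 := hNv w₂ hv2.1 hv2.2
    have h12 : ¬ H.Adj w₁ w₂ := hE.cyclic.not_adj_of_diamond hadj hu1 hv1.1 hu2 hv2.1
    set K : Finset W := {u, v, w₁, w₂} with hKdef
    have hmemK : ∀ c, c ∈ K ↔ c = u ∨ c = v ∨ c = w₁ ∨ c = w₂ := by simp [hKdef]
    have huK : u ∈ K := by simp [hKdef]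
    have hvK : v ∈ K := by simp [hKdef]
    have hK : IsTightCore H u K :=
      hE.cyclic.isTightCore_diamond hadj hu1 hv1.1 hu2 hv2.1 hw12 huK
    have hNK : ∀ c, H.Adj v c → c ∈ K := by
      intro c hc
      rw [hmemK]
      by_cases hcu : c = u
      · exact Or.inl hcu
      · exact Or.inr (Or.inr ((hmem c).1 ⟨hc, hcu⟩))
    -- For `a = 3` no hypothesis is needed: without such a vertex the diamond would be all of `H`,
    -- which has at least five vertices.
    have hex : ∃ z, z ≠ u ∧ z ≠ v ∧ 3 ≤ vdeg H z := by
      rcases ha.lt_or_eq with h4 | h3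
      · exact hz h4
      · by_contra hcon
        push Not at hcon
        have hall := hE.cyclic.mem_of_isTightCore huv hK huK hvK (hu.trans h3.symm) hv
          fun z h1 h2 => by have := hcon z h1 h2; omega
        have h5 : Fintype.card W ≤ K.card :=
          (Finset.card_univ (α := W)) ▸ Finset.card_le_card fun x _ => hall x
        have h6 : K.card ≤ 4 := Finset.card_le_four
        omega
    obtain ⟨z, hzu, hzv, hz3⟩ := hex
    have hchild : ∃ x, x ∉ K ∧ H.Adj z x ∧ H.dist u x = H.dist u z + 1 := by
      by_cases hzK : z ∈ K
      · obtain ⟨x, hx, hxu, hxv⟩ := exists_adj_ne_ne_of_three_le_vdeg hz3 u v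
        have hzw := ((hmemK z).1 hzK).resolve_left hzu |>.resolve_left hzv
        have huz : H.Adj u z := by rcases hzw with rfl | rfl <;> assumption
        have hxK : x ∉ K := by
          intro h
          have hxw := ((hmemK x).1 h).resolve_left hxu |>.resolve_left hxv
          rcases hzw with rfl | rfl <;> rcases hxw with rfl | rfl
          · exact hx.ne rfl
          · exact h12 hx
          · exact h12 hx.symm
          · exact hx.ne rfl
        have hux : ¬ H.Adj u x := fun h => hzu (hK.eq_of_adj hxK hx.symm hzK h.symm huK)
        refine ⟨x, hxK, hx, ?_⟩
        have h1 := SimpleGraph.dist_eq_one_iff_adj.2 huz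
        have h2 : H.dist u x ≤ H.dist u z + H.dist z x := hE.connected.dist_triangle
        rw [SimpleGraph.dist_eq_one_iff_adj.2 hx] at h2
        have h3 : H.dist u x ≠ 1 := fun e => hux (SimpleGraph.dist_eq_one_iff_adj.1 e)
        have h4 : H.dist u x ≠ 0 := fun e => hxu ((hE.connected.dist_eq_zero_iff.1 e).symm)
        omega
      · obtain ⟨p, -, hp⟩ := hK z hzK
        obtain ⟨x, hx, hxp⟩ := exists_adj_ne_of_two_le_vdeg (by omega : 2 ≤ vdeg H z) p
        exact ⟨x, (hp x hx hxp).1, hx, (hp x hx hxp).2⟩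
    obtain ⟨x, hxK, hzx, hd⟩ := hchild
    have hxu : x ≠ u := fun e => hxK (e ▸ huK)
    have hxv : x ≠ v := fun e => hxK (e ▸ hvK)
    have hvx : ¬ H.Adj v x := fun e => hxK (hNK _ e)
    have hux : ¬ H.Adj u x := by
      intro e
      rw [SimpleGraph.dist_eq_one_iff_adj.2 e] at hd
      exact hzu ((hE.connected.dist_eq_zero_iff.1 (show H.dist u z = 0 by omega)).symm)
    have hfz : f v ≤ f z :=
      hE.le_of_adj_not_adj hN ha hu hv hzu hzv hz3 hzx hxu hux hzx hxv hvx
    have hw : ∃ w, (w = w₁ ∨ w = w₂) ∧ w ≠ z ∧ ¬ H.Adj z w := by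
      by_cases hzK : z ∈ K
      · rcases ((hmemK z).1 hzK).resolve_left hzu |>.resolve_left hzv with rfl | rfl
        · exact ⟨w₂, Or.inr rfl, hw12.symm, h12⟩
        · exact ⟨w₁, Or.inl rfl, hw12, fun e => h12 e.symm⟩
      · have hne : ∀ w ∈ K, w ≠ z := fun w hw e => hzK (e ▸ hw)
        have h1K : w₁ ∈ K := by simp [hKdef]
        have h2K : w₂ ∈ K := by simp [hKdef]
        by_cases hz1 : H.Adj z w₁
        · exact ⟨w₂, Or.inr rfl, hne _ h2K, fun e => hw12 (hK.eq_of_adj hzK hz1 h1K e h2K)⟩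
        · exact ⟨w₁, Or.inl rfl, hne _ h1K, hz1⟩
    obtain ⟨w, hw, hwz, hzw⟩ := hw
    have hvw := (hmem w).2 hw
    exact hE.improvable_of_descending huv hf (by omega) hNv hK huK hvK hNK hvw.1
      (two_le_vdeg hvw.1.symm (hNv w hvw.1 hvw.2).symm huv.symm) hzu hzv hxK hzx hwz hzw hd hfz
  · obtain ⟨w₁, w₂, w₃, h12, h13, h23, hset⟩ := Set.ncard_eq_three.1 hv
    have hmem : ∀ c, H.Adj v c ↔ (c = w₁ ∨ c = w₂ ∨ c = w₃) := fun c => by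
      have := Set.ext_iff.1 hset c
      simpa using this
    have hadjv : ∀ c, H.Adj v c → H.Adj u c := fun c hc =>
      hNv c hc fun e => hadj (e ▸ hc.symm)
    have hv1 := (hmem w₁).2 (by simp)
    have hv2 := (hmem w₂).2 (by simp)
    have hv3 := (hmem w₃).2 (by simp)
    have hu1 := hadjv _ hv1
    have hu2 := hadjv _ hv2
    have hu3 := hadjv _ hv3
    have hn12 := hE.cyclic.not_adj_of_three_common huv hu1 hv1 hu2 hv2 hu3 hv3 h13 h23
    have hn13 := hE.cyclic.not_adj_of_three_common huv hu1 hv1 hu3 hv3 hu2 hv2 h12 h23.symm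
    have hn23 := hE.cyclic.not_adj_of_three_common huv hu2 hv2 hu3 hv3 hu1 hv1 h12.symm h13.symm
    have k12 := hE.improvable_of_not_adj huv hf hadj hv1 hv2 hu1 hu2 h12 hn12
    have k13 := hE.improvable_of_not_adj huv hf hadj hv1 hv3 hu1 hu3 h13 hn13
    have k23 := hE.improvable_of_not_adj huv hf hadj hv2 hv3 hu2 hu3 h23 hn23
    -- Two of the three weights `f w₁`, `f w₂`, `f w₃` lie on the same side of `f v`, which makes
    -- the product for that pair nonnegative.
    rcases le_total (f v) (f w₁) with h1 | h1 <;> rcases le_total (f v) (f w₂) with h2 | h2 <;>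
      rcases le_total (f v) (f w₃) with h3 | h3 <;>
      first
      | exact k12 (mul_nonneg (sub_nonneg.2 h1) (sub_nonneg.2 h2))
      | exact k12 (mul_nonneg_of_nonpos_of_nonpos (sub_nonpos.2 h1) (sub_nonpos.2 h2))
      | exact k13 (mul_nonneg (sub_nonneg.2 h1) (sub_nonneg.2 h3))
      | exact k13 (mul_nonneg_of_nonpos_of_nonpos (sub_nonpos.2 h1) (sub_nonpos.2 h3))
      | exact k23 (mul_nonneg (sub_nonneg.2 h2) (sub_nonneg.2 h3))
      | exact k23 (mul_nonneg_of_nonpos_of_nonpos (sub_nonpos.2 h2) (sub_nonpos.2 h3))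

end CaseThree

/-! ### The lower degree equals two -/

section CaseTwo

variable {W : Type*} [Fintype W] {H : SimpleGraph W} {α : ℝ} {f : W → ℝ} {a : ℕ}

theorem eq_of_adj_of_vdeg_eq_one {l y z : W} (hl : vdeg H l = 1) (hy : H.Adj l y)
    (hz : H.Adj l z) : y = z := by
  by_contra h
  have := two_le_vdeg hy hz h
  omega

theorem SimpleGraph.Connected.vdeg_pos (hH : H.Connected) {u z : W} (hzu : z ≠ u) :
    0 < vdeg H z := by
  obtain ⟨p, hp, -⟩ := hH.exists_adj_dist_add_one u hzu
  exact vdeg_pos_of_adj hp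

theorem SimpleGraph.Connected.two_le_vdeg_of_leaf (hH : H.Connected) {u l y : W}
    (hl : vdeg H l = 1) (hy : H.Adj y l) (hyu : y ≠ u) (hlu : l ≠ u) : 2 ≤ vdeg H y := by
  obtain ⟨p, hp, hpd⟩ := hH.exists_adj_dist_add_one u hyu
  obtain ⟨q, hq, hqd⟩ := hH.exists_adj_dist_add_one u hlu
  have := eq_of_adj_of_vdeg_eq_one hl hq hy.symm
  subst this
  refine two_le_vdeg hp hy ?_
  rintro rfl
  omega

/-- A pendant edge `yl` serves in the double move: `w` is adjacent to both `u` and `v` or equals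
`u`, so it is not a leaf and `f l ≤ f w`. -/
theorem IsExtremalWeight.improvable_of_leaf (hE : IsExtremalWeight H α f) (ha : 2 ≤ a)
    (hN : PairsNested H f a 2) {u v : W} (huv : u ≠ v) (hu : vdeg H u = a) (hv : vdeg H v = 2)
    (hf : f v ≤ f u) {l y w : W} (hl : vdeg H l = 1) (hyl : H.Adj y l) (hyu : y ≠ u)
    (hy : 2 ≤ vdeg H y) (hw : H.Adj v w) (hwy : w ≠ y) (hyw : ¬ H.Adj y w) :
    Improvable H α f a 2 := by
  have hNv := hN u v huv hu hv hf
  have hlu : l ≠ u := by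
    rintro rfl
    omega
  have hlv : l ≠ v := by
    rintro rfl
    omega
  have hul : ¬ H.Adj u l := fun h => hyu (eq_of_adj_of_vdeg_eq_one hl hyl.symm h.symm)
  have hvl : ¬ H.Adj v l := fun h => hul (hNv l h hlu)
  have hyv : y ≠ v := fun e => hvl (e ▸ hyl)
  have hw2 : 2 ≤ vdeg H w := by
    by_cases hwu : w = u
    · rw [hwu]
      omega
    · exact two_le_vdeg hw.symm (hNv w hw hwu).symm huv.symm
  rw [← hu, ← hv]
  exact hE.improvable_of_edge huv hf (by omega) hNv hw hyl hyu hyv hlu hlv hwy hyw hul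
    (hE.le_of_adj_not_adj hN ha hu hv hyu hyv hy hyl hlu hul hyl hlv hvl)
    (hE.le_of_vdeg_lt (by omega))

/-- A deepest nonleaf outside the core has a leaf as child, and it is not adjacent to both
neighbours of `v`, since a vertex outside has at most one neighbour in the core. -/
theorem IsExtremalWeight.improvable_of_isTightCore (hE : IsExtremalWeight H α f) (ha : 2 ≤ a)
    (hN : PairsNested H f a 2) {u v : W} (huv : u ≠ v) (hu : vdeg H u = a) (hv : vdeg H v = 2)
    (hf : f v ≤ f u) {K : Finset W} (hK : IsTightCore H u K) (huK : u ∈ K)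
    (hNK : ∀ c, H.Adj v c → c ∈ K) {z : W} (hzK : z ∉ K) (hz : 2 ≤ vdeg H z) :
    Improvable H α f a 2 := by
  classical
  set Z := Finset.univ.filter fun z => z ∉ K ∧ 2 ≤ vdeg H z with hZ
  obtain ⟨y, hy, hmax⟩ := Z.exists_max_image (fun z => H.dist u z)
    ⟨z, by rw [hZ, Finset.mem_filter]; exact ⟨Finset.mem_univ _, hzK, hz⟩⟩
  simp only [hZ, Finset.mem_filter, Finset.mem_univ, true_and] at hy hmax
  obtain ⟨p, -, hp⟩ := hK y hy.1
  obtain ⟨l, hyl, hlp⟩ := exists_adj_ne_of_two_le_vdeg hy.2 p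
  have hl := hp l hyl hlp
  have hl1 : vdeg H l = 1 := by
    have h1 := vdeg_pos_of_adj hyl.symm
    by_contra h
    have := hmax l ⟨hl.1, by omega⟩
    omega
  have hyu : y ≠ u := fun e => hy.1 (e ▸ huK)
  have hne : ∀ w ∈ K, w ≠ y := fun w hw e => hy.1 (e ▸ hw)
  obtain ⟨c, hc, -⟩ := exists_adj_ne_of_two_le_vdeg hv.ge v
  obtain ⟨d, hd, hdc⟩ := exists_adj_ne_of_two_le_vdeg hv.ge c
  by_cases hyc : H.Adj y c
  · exact hE.improvable_of_leaf ha hN huv hu hv hf hl1 hyl hyu hy.2 hd (hne d (hNK d hd))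
      fun h => hdc (hK.eq_of_adj hy.1 h (hNK d hd) hyc (hNK c hc))
  · exact hE.improvable_of_leaf ha hN huv hu hv hf hl1 hyl hyu hy.2 hc (hne c (hNK c hc)) hyc

/-- The vertices of degree at least two. -/
noncomputable def nonleaves {W : Type*} [Fintype W] (H : SimpleGraph W) : Finset W :=
  Finset.univ.filter fun z => 2 ≤ vdeg H z

theorem mem_nonleaves {z : W} : z ∈ nonleaves H ↔ 2 ≤ vdeg H z := by simp [nonleaves]

theorem exists_mem_nonleaves_notMem (h5 : 5 ≤ (nonleaves H).card) {K : Finset W}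
    (hK : K.card ≤ 4) : ∃ z ∉ K, 2 ≤ vdeg H z := by
  obtain ⟨z, hz, hzK⟩ := Finset.exists_mem_notMem_of_card_lt_card
    (show K.card < (nonleaves H).card by omega)
  exact ⟨z, hzK, mem_nonleaves.1 hz⟩

/-- Otherwise `u`, `v` share both neighbours of `v`. If these are adjacent, there is a diamond and a
nonleaf outside it; if not, both weigh at least `f v` and `improvable_of_not_adj` applies. -/
theorem IsExtremalWeight.adj_of_two (hE : IsExtremalWeight H α f) (ha : 2 ≤ a)
    (hI : ¬ Improvable H α f a 2) (h5 : 5 ≤ (nonleaves H).card) {u v : W} (huv : u ≠ v)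
    (hu : vdeg H u = a) (hv : vdeg H v = 2) (hf : f v ≤ f u) : H.Adj u v := by
  classical
  have hN := hE.pairsNested hI le_rfl
  have hNv := hN u v huv hu hv hf
  by_contra hadj
  obtain ⟨w₁, w₂, h12, hset⟩ := Set.ncard_eq_two.1 hv
  have hmem : ∀ c, H.Adj v c ↔ (c = w₁ ∨ c = w₂) := fun c => by
    have := Set.ext_iff.1 hset c
    simpa using this
  have hadjv : ∀ c, H.Adj v c → H.Adj u c := fun c hc =>
    hNv c hc fun e => hadj (e ▸ hc.symm)
  have hv1 := (hmem w₁).2 (by simp)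
  have hv2 := (hmem w₂).2 (by simp)
  have hu1 := hadjv _ hv1
  have hu2 := hadjv _ hv2
  by_cases hw : H.Adj w₁ w₂
  · have hK : IsTightCore H u {w₁, w₂, u, v} :=
      hE.cyclic.isTightCore_diamond hw hu1.symm hu2.symm hv1.symm hv2.symm huv (by simp)
    obtain ⟨z, hzK, hz⟩ := exists_mem_nonleaves_notMem h5
      (Finset.card_le_four (a := w₁) (b := w₂) (c := u) (d := v))
    refine hI (hE.improvable_of_isTightCore ha hN huv hu hv hf hK (by simp) (fun c hc => ?_)
      hzK hz)
    rcases (hmem c).1 hc with rfl | rfl <;> simp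
  · have key : ∀ w, H.Adj v w → f v ≤ f w := fun w hvw =>
      hE.le_of_adj_not_adj hN ha hu hv (hadjv w hvw).ne' hvw.ne'
        (two_le_vdeg hvw.symm (hadjv w hvw).symm huv.symm) hvw.symm huv.symm hadj
        (hadjv w hvw).symm huv fun h => hadj h.symm
    have h := hE.improvable_of_not_adj huv hf hadj hv1 hv2 hu1 hu2 h12 hw
      (mul_nonneg (sub_nonneg.2 (key w₁ hv1)) (sub_nonneg.2 (key w₂ hv2)))
    rw [hu, hv] at h
    exact hI h

/-- A second common neighbour of `u` and `w` would complete a diamond. A leaf attached elsewhere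
would allow an improvement, its neighbour missing `u` or `w`. -/
theorem IsExtremalWeight.exists_triangle_of_two (hE : IsExtremalWeight H α f) (ha : 2 ≤ a)
    (hI : ¬ Improvable H α f a 2) (h5 : 5 ≤ (nonleaves H).card) {u v : W} (huv : u ≠ v)
    (hu : vdeg H u = a) (hv : vdeg H v = 2) (hf : f v ≤ f u) :
    ∃ w, w ≠ u ∧ H.Adj v w ∧ H.Adj u w ∧ (∀ c, H.Adj v c → c = u ∨ c = w) ∧
      (∀ y, H.Adj u y → H.Adj w y → y = v) ∧
      ∀ l y, vdeg H l = 1 → H.Adj y l → y = u ∨ y = w := by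
  classical
  have hN := hE.pairsNested hI le_rfl
  have hNv := hN u v huv hu hv hf
  have hadj := hE.adj_of_two ha hI h5 huv hu hv hf
  obtain ⟨w, hvw, hwu⟩ := exists_adj_ne_of_two_le_vdeg hv.ge u
  have huw := hNv w hvw hwu
  have hnb : ∀ c, H.Adj v c → c = u ∨ c = w := by
    intro c hc
    by_contra hcon
    push Not at hcon
    have h3 : ({u, w, c} : Finset W) ⊆ Finset.univ.filter (H.Adj v) := by
      intro x hx
      simp only [Finset.mem_insert, Finset.mem_singleton] at hx
      rcases hx with rfl | rfl | rfl <;> simp [hadj.symm, hvw, hc]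
    have h4 := Finset.card_le_card h3
    rw [← vdeg_eq_card, hv, Finset.card_eq_three.2
      ⟨u, w, c, hwu.symm, hcon.1.symm, hcon.2.symm, rfl⟩] at h4
    omega
  have hcom : ∀ y, H.Adj u y → H.Adj w y → y = v := by
    intro y huy hwy
    by_contra hyv
    have hK : IsTightCore H u {u, w, v, y} :=
      hE.cyclic.isTightCore_diamond huw hadj hvw.symm huy hwy (Ne.symm hyv) (by simp)
    obtain ⟨z, hzK, hz⟩ := exists_mem_nonleaves_notMem h5
      (Finset.card_le_four (a := u) (b := w) (c := v) (d := y))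
    refine hI (hE.improvable_of_isTightCore ha hN huv hu hv hf hK (by simp) (fun c hc => ?_)
      hzK hz)
    rcases hnb c hc with rfl | rfl <;> simp
  refine ⟨w, hwu, hvw, huw, hnb, hcom, fun l y hl hyl => ?_⟩
  by_contra hcon
  push Not at hcon
  have hlu : l ≠ u := by
    rintro rfl
    omega
  have hy2 := hE.connected.two_le_vdeg_of_leaf hl hyl hcon.1 hlu
  by_cases hyu : H.Adj y u
  · by_cases hyw : H.Adj y w
    · have hyv := hcom y hyu.symm hyw.symm
      subst hyv
      rcases hnb l hyl with h | h
      · exact hlu h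
      · subst h
        have := two_le_vdeg hvw.symm huw.symm huv.symm
        omega
    · exact hI (hE.improvable_of_leaf ha hN huv hu hv hf hl hyl hcon.1 hy2 hvw
        (Ne.symm hcon.2) hyw)
  · exact hI (hE.improvable_of_leaf ha hN huv hu hv hf hl hyl hcon.1 hy2 hadj.symm
      (Ne.symm hcon.1) hyu)

/-- Discharging: the excesses `vdeg - 2` sum to two. Let `u` and `w` each give one unit to every
neighbour. Then `u` and `w` end at `-1` each, `v` at `2`, and leaves at zero or more. Neighbours of
`o` other than `u`, `w` keep at least one unit, as does `o`, which also receives a unit for each of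
`u`, `w` adjacent to it. The total is at least `vdeg H o + 1`, a contradiction. -/
theorem IsCyclicGraph.false_of_hubs (hH : IsCyclicGraph 2 H) {u v w o : W} (hv : vdeg H v = 2)
    (huv : H.Adj u v) (hwv : H.Adj w v) (huw : H.Adj u w)
    (hnb : ∀ c, H.Adj v c → c = u ∨ c = w)
    (hleaf : ∀ l y, vdeg H l = 1 → H.Adj y l → y = u ∨ y = w) (hou : o ≠ u) (hov : o ≠ v)
    (how : o ≠ w) (ho : 3 ≤ vdeg H o) (hnbo : ∀ c, H.Adj o c → c = u ∨ c = w ∨ 3 ≤ vdeg H c) :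
    False := by
  classical
  have hvo : ¬ H.Adj o v := fun h => by
    rcases hnb o h.symm with h | h
    · exact hou h
    · exact how h
  have hpt : ∀ z, (if z = u then vdeg H u else 0) + (if z = w then vdeg H w else 0) +
      (if z = v then 2 else 0) + (if H.Adj o z then 1 else 0) +
      (if z = o then 1 + (if H.Adj o u then 1 else 0) + (if H.Adj o w then 1 else 0) else 0) + 2 ≤
      vdeg H z + (if H.Adj u z then 1 else 0) + (if H.Adj w z then 1 else 0) +
      (if z = u then 1 + (if H.Adj o u then 1 else 0) else 0) +
      (if z = w then 1 + (if H.Adj o w then 1 else 0) else 0) := by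
    intro z
    by_cases hzu : z = u
    · subst hzu
      simp [huv.ne, huw.ne, hou.symm, huw.symm]
      omega
    by_cases hzw : z = w
    · subst hzw
      simp [hwv.ne, huw.ne', how.symm, huw]
      omega
    by_cases hzv : z = v
    · subst hzv
      simp [hzu, hzw, huv, hwv, hvo, hov.symm, hv]
    by_cases hzo : z = o
    · subst hzo
      simp only [hzu, hzw, hzv, if_false, if_true, H.adj_comm u z, H.adj_comm w z,
        SimpleGraph.irrefl]
      split_ifs <;> omega
    have hz := hH.1.vdeg_pos hzu
    simp only [hzu, hzw, hzv, hzo, if_false]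
    by_cases hoz : H.Adj o z
    · have := ((hnbo z hoz).resolve_left hzu).resolve_left hzw
      simp only [hoz, if_true]
      split_ifs <;> omega
    · simp only [hoz, if_false]
      by_cases h1 : vdeg H z = 1
      · obtain ⟨y, hy, -⟩ := hH.1.exists_adj_dist_add_one u hzu
        rcases hleaf z y h1 hy.symm with rfl | rfl
        · simp [hy.symm, h1]
        · simp [hy.symm, h1]
      · omega
  have hsum := Finset.sum_le_sum fun z (_ : z ∈ (Finset.univ : Finset W)) => hpt z
  simp only [Finset.sum_add_distrib, Finset.sum_ite_eq', Finset.mem_univ, if_true,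
    Finset.sum_const, Finset.card_univ, smul_eq_mul] at hsum
  have hind : ∀ c, ∑ z, (if H.Adj c z then 1 else 0) = vdeg H c := fun c => by
    rw [vdeg_eq_card, Finset.card_filter]
  simp only [hind] at hsum
  have := ((isCyclicGraph_iff 2 H).1 hH).2
  omega

theorem IsExtremalWeight.improvable_of_two (hE : IsExtremalWeight H α f) (ha : 2 ≤ a)
    (haW : a + 2 ≤ Fintype.card W) (h5 : 5 ≤ (nonleaves H).card) {u v : W} (huv : u ≠ v)
    (hu : vdeg H u = a) (hv : vdeg H v = 2) (hf : f v ≤ f u) : Improvable H α f a 2 := by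
  classical
  by_contra hI
  have hN := hE.pairsNested hI le_rfl
  have hadj := hE.adj_of_two ha hI h5 huv hu hv hf
  obtain ⟨w, hwu, hvw, huw, hnb, hcom, hleaf⟩ := hE.exists_triangle_of_two ha hI h5 huv hu hv hf
  have hfalse := fun o => hE.cyclic.false_of_hubs (o := o) hv hadj hvw.symm huw hnb hleaf
  -- In the first case two triangles at `u` with different third vertices force all leaves to hang
  -- at `u`, and a vertex not adjacent to `u` serves as `o`. In the second, all nonleaves outside
  -- the triangle have degree at least three, and any of them serves as `o`.
  by_cases hQ : 3 ≤ a ∧ ∃ z, z ≠ u ∧ z ≠ v ∧ z ≠ w ∧ vdeg H z = 2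
  · obtain ⟨ha3, z, hzu, hzv, hzw, hz⟩ := hQ
    have hfu : ∀ z, vdeg H z = 2 → f z ≤ f u := fun z hz => hE.le_of_vdeg_lt (by omega)
    have huz := hE.adj_of_two ha hI h5 hzu.symm hu hz (hfu z hz)
    obtain ⟨c, hcu, hzc, huc, -, -, hleafz⟩ :=
      hE.exists_triangle_of_two ha hI h5 hzu.symm hu hz (hfu z hz)
    have hcw : c ≠ w := fun e => hzv (hcom z huz (e ▸ hzc.symm))
    have hleafu : ∀ l y, vdeg H l = 1 → H.Adj y l → y = u := by
      intro l y hl hyl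
      rcases hleaf l y hl hyl with h | h
      · exact h
      · exact (hleafz l y hl hyl).resolve_right fun h' => hcw (h'.symm.trans h)
    obtain ⟨x, hx⟩ : ∃ x, x ∉ insert u (Finset.univ.filter (H.Adj u)) := by
      by_contra hcon
      push Not at hcon
      have h1 : Fintype.card W ≤ (insert u (Finset.univ.filter (H.Adj u))).card :=
        (Finset.card_univ (α := W)) ▸ Finset.card_le_card fun x _ => hcon x
      have h2 := Finset.card_insert_le u (Finset.univ.filter (H.Adj u))
      rw [← vdeg_eq_card] at h2
      omega
    simp only [Finset.mem_insert, Finset.mem_filter, Finset.mem_univ, true_and, not_or] at hx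
    obtain ⟨hxu, hux⟩ := hx
    have hx3 : 3 ≤ vdeg H x := by
      have h1 := hE.connected.vdeg_pos hxu
      have h2 : vdeg H x ≠ 2 := fun h =>
        hux (hE.adj_of_two ha hI h5 (Ne.symm hxu) hu h (hfu x h))
      have h3 : vdeg H x ≠ 1 := by
        intro h
        obtain ⟨y, hy, -⟩ := hE.connected.exists_adj_dist_add_one u hxu
        exact hux ((hleafu x y h hy.symm) ▸ hy.symm)
      omega
    refine hfalse x hxu (fun e => hux (e ▸ hadj)) (fun e => hux (e ▸ huw)) hx3 fun c hc => ?_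
    by_cases hcu : c = u
    · exact Or.inl hcu
    refine Or.inr (Or.inr ?_)
    have h1 := vdeg_pos_of_adj hc.symm
    have h2 : vdeg H c ≠ 1 := fun h => hxu (hleafu c x h hc)
    have h3 : vdeg H c ≠ 2 := fun h =>
      hux (hN u c (Ne.symm hcu) hu h (hfu c h) x hc.symm hxu)
    omega
  · have hbig : ∀ z, z ≠ u → z ≠ v → z ≠ w → 2 ≤ vdeg H z → 3 ≤ vdeg H z := by
      intro z hzu hzv hzw hz
      by_contra hlt
      have hz2 : vdeg H z = 2 := by omega
      have ha2 : a = 2 := by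
        by_contra h
        exact hQ ⟨by omega, z, hzu, hzv, hzw, hz2⟩
      have hzadj : H.Adj u z := by
        rcases le_total (f z) (f u) with h | h
        · exact hE.adj_of_two ha hI h5 hzu.symm hu hz2 h
        · exact (hE.adj_of_two ha hI h5 hzu (hz2.trans ha2.symm) (hu.trans ha2) h).symm
      have h3 : ({v, w, z} : Finset W) ⊆ Finset.univ.filter (H.Adj u) := by
        intro x hx
        simp only [Finset.mem_insert, Finset.mem_singleton] at hx
        rcases hx with rfl | rfl | rfl <;> simp [hadj, huw, hzadj]
      have h4 := Finset.card_le_card h3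
      rw [← vdeg_eq_card, hu, Finset.card_eq_three.2
        ⟨v, w, z, hvw.ne, hzv.symm, hzw.symm, rfl⟩] at h4
      omega
    obtain ⟨o, hoK, ho⟩ := exists_mem_nonleaves_notMem h5
      (show ({u, v, w} : Finset W).card ≤ 4 from
        (Finset.card_le_three (a := u) (b := v) (c := w)).trans (by norm_num))
    simp only [Finset.mem_insert, Finset.mem_singleton, not_or] at hoK
    refine hfalse o hoK.1 hoK.2.1 hoK.2.2 (hbig o hoK.1 hoK.2.1 hoK.2.2 ho) fun c hc => ?_
    by_cases hcu : c = u
    · exact Or.inl hcu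
    by_cases hcw : c = w
    · exact Or.inr (Or.inl hcw)
    have hcv : c ≠ v := by
      rintro rfl
      rcases hnb o hc.symm with h | h
      · exact hoK.1 h
      · exact hoK.2.2 h
    refine Or.inr (Or.inr (hbig c hcu hcv hcw ?_))
    have h1 := vdeg_pos_of_adj hc.symm
    by_contra hlt
    rcases hleaf c o (by omega) hc with h | h
    · exact hoK.1 h
    · exact hoK.2.2 h

end CaseTwo

/-! ### Improving extremal weights -/

section Improve

variable {W : Type*} [Fintype W] {H : SimpleGraph W} {α : ℝ} {f : W → ℝ} {a b : ℕ}

/-- When `a = b` the roles of `u` and `v` may be exchanged, so `f v ≤ f u` is no restriction;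
nesting then leaves only `b = 2` and `b = 3`. -/
theorem IsExtremalWeight.improvable (hE : IsExtremalWeight H α f) (hb : 2 ≤ b) (hab : b ≤ a)
    (haW : a + 2 ≤ Fintype.card W) (hcard : 5 ≤ Fintype.card W)
    (h5 : b = 2 → 5 ≤ (nonleaves H).card)
    (h3 : b = 3 → 4 ≤ a → ∀ u v : W, ∃ z, z ≠ u ∧ z ≠ v ∧ 3 ≤ vdeg H z) {u v : W} (huv : u ≠ v)
    (hu : vdeg H u = a) (hv : vdeg H v = b) : Improvable H α f a b := by
  wlog hf : f v ≤ f u generalizing u v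
  · rcases hab.lt_or_eq with h | h
    · exact absurd (hE.le_of_vdeg_lt (by omega)) hf
    · exact this huv.symm (hv.trans h) (hu.trans h.symm) (not_le.1 hf).le
  by_contra hI
  have hN := hE.pairsNested hI hb
  have hb3 := hE.cyclic.vdeg_le_three_of_nested huv (hN u v huv hu hv hf)
  rw [hv] at hb3
  have : b = 2 ∨ b = 3 := by omega
  rcases this with rfl | rfl
  · exact hI (hE.improvable_of_two hab haW (h5 rfl) huv hu hv hf)
  · exact hI (hE.improvable_of_three hab hN hcard huv hu hv hf fun h => h3 rfl h u v)

end Improve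

/-! ### Degree sequences of cones -/

theorem vdeg_lt_card {V : Type*} [Fintype V] (G : SimpleGraph V) (x : V) :
    vdeg G x < Fintype.card V := by
  classical
  rw [vdeg_eq_degree]
  exact G.degree_lt_card_verts x

theorem vdeg_top {V : Type*} [Fintype V] (x : V) :
    vdeg (⊤ : SimpleGraph V) x = Fintype.card V - 1 := by
  classical
  rw [vdeg_eq_degree]
  convert SimpleGraph.complete_graph_degree x

theorem vdeg_cone_inl {n t : ℕ} (ht : t ≤ n) (H : SimpleGraph (Fin (n - t))) (i : Fin t) :
    vdeg (graphJoin (⊤ : SimpleGraph (Fin t)) H) (Sum.inl i) = n - 1 := by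
  rw [vdeg_join_inl, vdeg_top, Fintype.card_fin, Fintype.card_fin]
  have := i.2
  omega

theorem vdeg_cone_inr {n t : ℕ} (H : SimpleGraph (Fin (n - t))) (z : Fin (n - t)) :
    vdeg (graphJoin (⊤ : SimpleGraph (Fin t)) H) (Sum.inr z) = t + vdeg H z := by
  rw [vdeg_join_inr, Fintype.card_fin]

theorem exists_of_mem_coneCyclicClass {n t c : ℕ} {d : Fin n → ℕ} {G : SimpleGraph (Fin n)}
    (hG : G ∈ coneCyclicClass d t c) :
    t ≤ n ∧ Antitone d ∧ ∃ H : SimpleGraph (Fin (n - t)), IsCyclicGraph c H ∧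
      Nonempty (G ≃g graphJoin (⊤ : SimpleGraph (Fin t)) H) ∧
      ∃ τ : Fin n ≃ Fin t ⊕ Fin (n - t),
        ∀ i, vdeg (graphJoin (⊤ : SimpleGraph (Fin t)) H) (τ i) = d i := by
  obtain ⟨⟨ht, H, hH, ⟨e⟩⟩, hd, σ, hσ⟩ := hG
  exact ⟨ht, hd, H, hH, ⟨e⟩, σ.trans e.toEquiv, fun i => (vdeg_iso e (σ i)).trans (hσ i)⟩

theorem exists_mem_coneCyclicClass {n t c : ℕ} {d : Fin n → ℕ} (ht : t ≤ n) (hd : Antitone d)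
    {H : SimpleGraph (Fin (n - t))} (hH : IsCyclicGraph c H) (τ : Fin n ≃ Fin t ⊕ Fin (n - t))
    (hτ : ∀ i, vdeg (graphJoin (⊤ : SimpleGraph (Fin t)) H) (τ i) = d i) :
    ∃ G ∈ coneCyclicClass d t c, Nonempty (G ≃g graphJoin (⊤ : SimpleGraph (Fin t)) H) := by
  have e := SimpleGraph.Iso.comap τ (graphJoin (⊤ : SimpleGraph (Fin t)) H)
  refine ⟨(graphJoin (⊤ : SimpleGraph (Fin t)) H).comap τ, ⟨⟨ht, H, hH, ⟨e⟩⟩, hd,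
    Equiv.refl _, fun i => ?_⟩, ⟨e⟩⟩
  exact (vdeg_iso (SimpleGraph.Iso.comap τ _) i).symm.trans (hτ i)

theorem IsThetaMaximal.le_of_cone {n t c : ℕ} {α : ℝ} {d : Fin n → ℕ} {G : SimpleGraph (Fin n)}
    (hG : IsThetaMaximal α (coneCyclicClass d t c) G) {H : SimpleGraph (Fin (n - t))}
    (hH : IsCyclicGraph c H) (τ : Fin n ≃ Fin t ⊕ Fin (n - t))
    (hτ : ∀ i, vdeg (graphJoin (⊤ : SimpleGraph (Fin t)) H) (τ i) = d i) :
    generalSpectralRadius (graphJoin (⊤ : SimpleGraph (Fin t)) H) α ≤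
      generalSpectralRadius G α := by
  obtain ⟨ht, hd, -⟩ := exists_of_mem_coneCyclicClass hG.1
  obtain ⟨G₁, hG₁, ⟨e⟩⟩ := exists_mem_coneCyclicClass ht hd hH τ hτ
  rw [← generalSpectralRadius_iso e]
  exact hG.2 G₁ hG₁

/-- The Perron vector of a maximal cone restricts to an extremal weight. -/
theorem IsThetaMaximal.isExtremalWeight {n t : ℕ} {α : ℝ} (hα : 0 ≤ α) {d : Fin n → ℕ}
    {G : SimpleGraph (Fin n)} (hG : IsThetaMaximal α (coneCyclicClass d t 2) G) (ht : t ≤ n)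
    {H : SimpleGraph (Fin (n - t))} (hH : IsCyclicGraph 2 H)
    (e : G ≃g graphJoin (⊤ : SimpleGraph (Fin t)) H) (τ : Fin n ≃ Fin t ⊕ Fin (n - t))
    (hτ : ∀ i, vdeg (graphJoin (⊤ : SimpleGraph (Fin t)) H) (τ i) = d i)
    {g : Fin t ⊕ Fin (n - t) → ℝ} (hpos : ∀ x, 0 < g x)
    (hg : ∀ x, mrow (graphJoin (⊤ : SimpleGraph (Fin t)) H) α g x =
      generalSpectralRadius (graphJoin (⊤ : SimpleGraph (Fin t)) H) α * g x) :
    IsExtremalWeight H α (g ∘ Sum.inr) := by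
  refine ⟨hα, fun x => hpos _, hH, fun H₂ hH₂ ⟨σ, hσ⟩ => ?_⟩
  by_contra hlt
  rw [not_le] at hlt
  obtain ⟨w⟩ := hH.1.nonempty
  have : Nonempty (Fin t ⊕ Fin (n - t)) := ⟨Sum.inr w⟩
  have h1 := spectralRadius_lt_of_quadForm_lt _
    (graphJoin (⊤ : SimpleGraph (Fin t)) H₂) g
    (fun h0 => (hpos (Sum.inr w)).ne' (congrFun h0 _)) hg (by
      have := quadForm_join_sub (⊤ : SimpleGraph (Fin t)) H H₂ α g
      linarith)
  have h2 := hG.le_of_cone hH₂ (τ.trans (Equiv.sumCongr (Equiv.refl _) σ)) (fun i => by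
    rw [← hτ i, Equiv.trans_apply]
    rcases τ i with j | z
    · rw [Equiv.sumCongr_apply, Sum.map_inl, vdeg_cone_inl ht, vdeg_cone_inl ht]
    · rw [Equiv.sumCongr_apply, Sum.map_inr, vdeg_cone_inr, vdeg_cone_inr, hσ])
  rw [generalSpectralRadius_iso e] at h2
  exact absurd h1 (not_lt.2 h2)

/-- An improvement may take place at another pair with the same two degrees; this carries it back to
the pair prescribed by the sequences. -/
theorem exists_perm_map_pair {W : Type*} {k : W → ℕ} {u v u₂ v₂ : W} (huv : u ≠ v)
    (huv₂ : u₂ ≠ v₂) (hu : k u = k u₂) (hv : k v = k v₂) :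
    ∃ ρ : Equiv.Perm W, ρ u = u₂ ∧ ρ v = v₂ ∧ ∀ z, k (ρ z) = k z := by
  classical
  have hswap : ∀ x y z, k x = k y → k (Equiv.swap x y z) = k z := by
    intro x y z h
    by_cases hx : z = x
    · rw [hx, Equiv.swap_apply_left, h]
    · by_cases hy : z = y
      · rw [hy, Equiv.swap_apply_right, h]
      · rw [Equiv.swap_apply_of_ne_of_ne hx hy]
  have hne : u₂ ≠ Equiv.swap u u₂ v := by
    intro h
    have h2 : Equiv.swap u u₂ u = Equiv.swap u u₂ v := by rw [Equiv.swap_apply_left, ← h]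
    exact huv ((Equiv.swap u u₂).injective h2)
  refine ⟨(Equiv.swap u u₂).trans (Equiv.swap (Equiv.swap u u₂ v) v₂), ?_, ?_, fun z => ?_⟩
  · rw [Equiv.trans_apply, Equiv.swap_apply_left, Equiv.swap_apply_of_ne_of_ne hne huv₂]
  · rw [Equiv.trans_apply, Equiv.swap_apply_left]
  · rw [Equiv.trans_apply, hswap _ _ _ ((hswap _ _ _ hu).trans hv), hswap _ _ _ hu]

theorem card_filter_eq_add_nonleaves {n t : ℕ} (ht : t + 3 ≤ n) {d : Fin n → ℕ}
    {H : SimpleGraph (Fin (n - t))} (τ : Fin n ≃ Fin t ⊕ Fin (n - t))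
    (hτ : ∀ i, vdeg (graphJoin (⊤ : SimpleGraph (Fin t)) H) (τ i) = d i) :
    (∑ i, if t + 2 ≤ d i then 1 else 0) = t + (nonleaves H).card := by
  simp only [← hτ]
  rw [Equiv.sum_comp τ fun y =>
    if t + 2 ≤ vdeg (graphJoin (⊤ : SimpleGraph (Fin t)) H) y then 1 else 0,
    Fintype.sum_sum_type]
  simp only [vdeg_cone_inl (by omega : t ≤ n), vdeg_cone_inr, nonleaves, Finset.card_filter,
    Nat.add_le_add_iff_left]
  rw [if_pos (by omega)]
  simp

/-- With `s` nonleaves and `l` leaves the total degree `2 (s + l) + 2` is at most `s (s - 1) + 2 l`,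
which fails for `s ≤ 3`. -/
theorem IsCyclicGraph.four_le_card_nonleaves {W : Type*} [Fintype W] {H : SimpleGraph W}
    (hH : IsCyclicGraph 2 H) : 4 ≤ (nonleaves H).card := by
  classical
  set B := nonleaves H with hB
  have hmem : ∀ z, z ∈ B ↔ 2 ≤ vdeg H z := fun z => mem_nonleaves
  have hsplit : ∀ z ∈ B, vdeg H z + 1 ≤ B.card + ∑ l ∈ Bᶜ, if H.Adj z l then 1 else 0 := by
    intro z hz
    have h1 : vdeg H z = ∑ l ∈ B, (if H.Adj z l then 1 else 0) +
        ∑ l ∈ Bᶜ, if H.Adj z l then 1 else 0 := by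
      rw [vdeg_eq_card, Finset.card_filter, Finset.sum_add_sum_compl]
    have h2 : ∑ l ∈ B, (if H.Adj z l then 1 else 0) + 1 ≤ B.card := by
      rw [← Finset.card_filter, Nat.add_one_le_iff]
      exact Finset.card_lt_card ⟨Finset.filter_subset _ _, fun h => by simpa using h hz⟩
    omega
  have hleaf : ∀ l ∈ Bᶜ, ∑ z ∈ B, (if H.Adj z l then 1 else 0) ≤ 1 := by
    intro l hl
    have h1 : vdeg H l < 2 := by simpa [hmem] using hl
    have h2 : ∑ z ∈ B, (if H.Adj z l then 1 else 0) ≤ vdeg H l := by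
      rw [vdeg_eq_card, ← Finset.card_filter]
      refine Finset.card_le_card fun z hz => ?_
      simpa using (Finset.mem_filter.1 hz).2.symm
    omega
  have h1 := Finset.sum_le_sum hsplit
  rw [Finset.sum_add_distrib, Finset.sum_add_distrib, Finset.sum_comm] at h1
  have h2 := Finset.sum_le_sum hleaf
  have h3 : ∑ z ∈ Bᶜ, vdeg H z + ∑ z ∈ B, vdeg H z = ∑ z, vdeg H z := by
    rw [add_comm, Finset.sum_add_sum_compl]
  have h4 : ∑ z ∈ Bᶜ, vdeg H z ≤ ∑ z ∈ Bᶜ, 1 := Finset.sum_le_sum fun z hz => by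
    have : vdeg H z < 2 := by simpa [hmem] using hz
    omega
  have h5 := ((isCyclicGraph_iff 2 H).1 hH).2
  have h6 := Finset.card_add_card_compl B
  simp only [Finset.sum_const, smul_eq_mul, mul_one] at h1 h2 h4
  by_contra hlt
  have h7 : B.card ≤ 3 := by omega
  interval_cases B.card <;> omega

/-! ### The exceptional sequences -/

/-- The number and the sum of the entries equal to `t + 1` or `t + 2` determine their
multiplicities; two sorted lists with the same multiset coincide. -/
theorem ofFn_eq_of_cone {n t m k A B : ℕ} {D : Fin n → ℕ} (hD : Antitone D)
    (τ : Fin n ≃ Fin t ⊕ Fin (n - t)) {u v : Fin (n - t)} (huv : u ≠ v)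
    (hinl : ∀ i, D (τ.symm (Sum.inl i)) = n - 1) (hu : D (τ.symm (Sum.inr u)) = A)
    (hv : D (τ.symm (Sum.inr v)) = B)
    (hrest : ∀ z, z ≠ u → z ≠ v →
      D (τ.symm (Sum.inr z)) = t + 1 ∨ D (τ.symm (Sum.inr z)) = t + 2)
    (hcard : m + k + 2 = n - t)
    (hsum : A + B + m * (t + 2) + k * (t + 1) = ∑ z, D (τ.symm (Sum.inr z)))
    (hA : A ≤ n - 1) (hAB : B ≤ A) (hB : t + 2 ≤ B) :
    List.ofFn D = List.replicate t (n - 1) ++ A :: B :: (List.replicate m (t + 2) ++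
      List.replicate k (t + 1)) := by
  classical
  set E : Fin (n - t) → ℕ := fun z => D (τ.symm (Sum.inr z)) with hE
  set R : Finset (Fin (n - t)) := (Finset.univ.erase u).erase v with hR
  have hvu : v ∈ Finset.univ.erase u := by simp [huv.symm]
  have huniv : (Finset.univ : Finset (Fin (n - t))) = insert u (insert v R) := by
    rw [hR, Finset.insert_erase hvu, Finset.insert_erase (Finset.mem_univ u)]
  have huR : u ∉ insert v R := by simp [hR, huv]
  have hvR : v ∉ R := by simp [hR]
  set m' := (R.filter fun z => E z = t + 2).card with hm'
  set k' := (R.filter fun z => ¬ E z = t + 2).card with hk'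
  have hRmap : R.val.map E = Multiset.replicate m' (t + 2) + Multiset.replicate k' (t + 1) := by
    rw [← Multiset.filter_add_not (fun z => E z = t + 2) R.val, Multiset.map_add]
    congr 1
    · rw [Multiset.eq_replicate, Multiset.card_map]
      refine ⟨rfl, fun b hb => ?_⟩
      obtain ⟨z, hz, rfl⟩ := Multiset.mem_map.1 hb
      exact (Multiset.mem_filter.1 hz).2
    · rw [Multiset.eq_replicate, Multiset.card_map]
      refine ⟨rfl, fun b hb => ?_⟩
      obtain ⟨z, hz, rfl⟩ := Multiset.mem_map.1 hb
      have hz' := Multiset.mem_filter.1 hz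
      have hzR : z ∈ R := hz'.1
      simp only [hR, Finset.mem_erase, Finset.mem_univ, and_true] at hzR
      exact (hrest z hzR.2 hzR.1).resolve_right hz'.2
  have hmap : (Finset.univ : Finset (Fin (n - t))).val.map E =
      A ::ₘ B ::ₘ (Multiset.replicate m' (t + 2) + Multiset.replicate k' (t + 1)) := by
    rw [huniv, Finset.insert_val_of_notMem huR, Finset.insert_val_of_notMem hvR,
      Multiset.map_cons, Multiset.map_cons, hRmap]
    congr 2
  have hc := congrArg Multiset.card hmap
  simp at hc
  have hs := congrArg Multiset.sum hmap
  simp only [Multiset.sum_cons, Multiset.sum_add, Multiset.sum_replicate, smul_eq_mul] at hs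
  have hs' : (Multiset.map E (Finset.univ : Finset (Fin (n - t))).val).sum = ∑ z, E z := rfl
  rw [hs', ← hsum] at hs
  have hmk : m' = m ∧ k' = k := by
    have h1 : m' + k' = m + k := by omega
    have h2 : m' * (t + 2) + k' * (t + 1) = m * (t + 2) + k * (t + 1) := by omega
    have h3 : m' + (m' + k') * (t + 1) = m + (m + k) * (t + 1) := by
      ring_nf at h2 ⊢
      omega
    rw [h1] at h3
    omega
  rw [hmk.1, hmk.2] at hmap
  have hall : (List.ofFn D : Multiset ℕ) = Multiset.replicate t (n - 1) +
      (A ::ₘ B ::ₘ (Multiset.replicate m (t + 2) + Multiset.replicate k (t + 1))) := by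
    rw [← Fin.univ_val_map, ← hmap]
    have h1 : (Finset.univ : Finset (Fin n)).val =
        (Finset.univ : Finset (Fin t ⊕ Fin (n - t))).val.map τ.symm :=
      (Multiset.map_univ_val_equiv τ.symm).symm
    rw [h1, Multiset.map_map, ← Finset.univ_disjSum_univ, Finset.val_disjSum, Multiset.disjSum,
      Multiset.map_add, Multiset.map_map, Multiset.map_map]
    congr 1
    rw [Multiset.eq_replicate, Multiset.card_map]
    refine ⟨by simp, fun b hb => ?_⟩
    obtain ⟨i, -, rfl⟩ := Multiset.mem_map.1 hb
    exact hinl i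
  have hperm : (List.ofFn D).Perm (List.replicate t (n - 1) ++ A :: B ::
      (List.replicate m (t + 2) ++ List.replicate k (t + 1))) := by
    rw [← Multiset.coe_eq_coe, hall]
    simp only [← Multiset.coe_replicate, Multiset.coe_add, Multiset.cons_coe]
  refine hperm.eq_of_pairwise (le := fun a b => b ≤ a) (fun a b _ _ h1 h2 => le_antisymm h2 h1)
    (List.pairwise_ofFn.2 fun i j hij => hD hij.le) ?_
  simp only [List.pairwise_append, List.pairwise_cons, List.mem_replicate, List.mem_cons,
    List.mem_append, List.pairwise_replicate]
  refine ⟨Or.inr le_rfl, ⟨?_, ?_, Or.inr le_rfl, Or.inr le_rfl, ?_⟩, ?_⟩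
  all_goals intros; omega

/-- If only two vertices have degree at least three and the smaller of their degrees is three, the
two sequences form an exceptional pair. -/
theorem isExceptionalPair_of_cone {n t a : ℕ} {d d' : Fin n → ℕ} (hd : Antitone d)
    (hd' : Antitone d') {p q : Fin n} (hp : d' p = d p + 1) (hq : d q = d' q + 1)
    (hpq : ∀ i, i ≠ p → i ≠ q → d i = d' i) {H : SimpleGraph (Fin (n - t))}
    (hH : IsCyclicGraph 2 H) (ht : t ≤ n) (τ : Fin n ≃ Fin t ⊕ Fin (n - t))
    (hτ : ∀ i, vdeg (graphJoin (⊤ : SimpleGraph (Fin t)) H) (τ i) = d i) {u v : Fin (n - t)}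
    (huv : u ≠ v) (hu : τ p = Sum.inr u) (hv : τ q = Sum.inr v) (hdu : vdeg H u = a)
    (hdv : vdeg H v = 3) (ha : 4 ≤ a) (han : t + a + 2 ≤ n)
    (hle : ∀ z, z ≠ u → z ≠ v → vdeg H z ≤ 2) : IsExceptionalPair t d d' := by
  classical
  have hsymm : ∀ y, d (τ.symm y) = vdeg (graphJoin (⊤ : SimpleGraph (Fin t)) H) y := fun y => by
    rw [← hτ, Equiv.apply_symm_apply]
  have hpu : τ.symm (Sum.inr u) = p := by rw [← hu, Equiv.symm_apply_apply]
  have hqv : τ.symm (Sum.inr v) = q := by rw [← hv, Equiv.symm_apply_apply]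
  have hother : ∀ y, y ≠ Sum.inr u → y ≠ Sum.inr v → d (τ.symm y) = d' (τ.symm y) :=
    fun y h1 h2 => hpq _ (fun h => h1 (by rw [← hu, ← h, Equiv.apply_symm_apply]))
      (fun h => h2 (by rw [← hv, ← h, Equiv.apply_symm_apply]))
  have hdp : d p = t + a := by rw [← hpu, hsymm, vdeg_cone_inr, hdu]
  have hdq : d q = t + 3 := by rw [← hqv, hsymm, vdeg_cone_inr, hdv]
  have hrest : ∀ z, z ≠ u → z ≠ v →
      d (τ.symm (Sum.inr z)) = t + 1 ∨ d (τ.symm (Sum.inr z)) = t + 2 := by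
    intro z hzu hzv
    have h1 := hH.1.vdeg_pos hzu
    have h2 := hle z hzu hzv
    rw [hsymm, vdeg_cone_inr]
    omega
  have hother' : ∀ z, z ≠ u → z ≠ v → d (τ.symm (Sum.inr z)) = d' (τ.symm (Sum.inr z)) :=
    fun z h1 h2 => hother _ (by simpa using h1) (by simpa using h2)
  -- The excesses over degree two sum to two, `(a - 2) + 1 - k = 2`, so `k = a - 3` is the number of
  -- leaves and `m` the number of vertices of degree two.
  obtain ⟨k, rfl⟩ : ∃ k, a = k + 3 := ⟨a - 3, by omega⟩
  obtain ⟨m, hm⟩ : ∃ m, n = m + t + k + 2 := ⟨n - t - k - 2, by omega⟩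
  have hsum : ∑ z, d (τ.symm (Sum.inr z)) = (m + k + 2) * (t + 2) + 2 := by
    simp only [hsymm, vdeg_cone_inr, Finset.sum_add_distrib, Finset.sum_const, Finset.card_univ,
      Fintype.card_fin, smul_eq_mul]
    have h := ((isCyclicGraph_iff 2 H).1 hH).2
    rw [Fintype.card_fin] at h
    have h2 : n - t = m + k + 2 := by omega
    have h3 : (n - t) * t = (m + k + 2) * t := by rw [h2]
    rw [mul_add]
    omega
  have hsum' : ∑ z, d' (τ.symm (Sum.inr z)) = ∑ z, d (τ.symm (Sum.inr z)) := by
    have hpt : ∀ z, d' (τ.symm (Sum.inr z)) + (if z = v then 1 else 0) =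
        d (τ.symm (Sum.inr z)) + (if z = u then 1 else 0) := by
      intro z
      by_cases hzu : z = u
      · subst hzu
        simp [huv, hpu, hp]
      by_cases hzv : z = v
      · subst hzv
        simp [hzu, hqv, hq]
      simp [hzu, hzv, hother' z hzu hzv]
    have h := Finset.sum_congr (s₁ := (Finset.univ : Finset (Fin (n - t)))) rfl fun z _ => hpt z
    simp only [Finset.sum_add_distrib, Finset.sum_ite_eq', Finset.mem_univ, if_true] at h
    omega
  have h1 := ofFn_eq_of_cone (m := m) (k := k) (A := t + (k + 3)) (B := t + 3) hd τ huv
    (fun i => by rw [hsymm, vdeg_cone_inl ht]) (by rw [hpu, hdp]) (by rw [hqv, hdq]) hrest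
    (by omega) (by rw [hsum]; ring) (by omega) (by omega) (by omega)
  -- The entry `B = t + 2` is later absorbed into the run of entries `t + 2`, which gets length `m +
  -- 1`.
  have h2 := ofFn_eq_of_cone (m := m) (k := k) (A := t + (k + 4)) (B := t + 2) hd' τ huv
    (fun i => by
      rw [← hother _ (by simp) (by simp), hsymm, vdeg_cone_inl ht])
    (by rw [hpu, hp, hdp]; ring) (by rw [hqv]; omega)
    (fun z hzu hzv => by rw [← hother' z hzu hzv]; exact hrest z hzu hzv)
    (by omega) (by rw [hsum', hsum]; ring) (by omega) (by omega) le_rfl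
  refine ⟨k, by omega, by omega, ?_, ?_⟩
  · rw [h1, show n - t - k - 2 = m by omega]
    simp [add_assoc]
  · rw [h2, show n - t - k - 1 = m + 1 by omega, List.replicate_succ]
    simp [add_assoc]

/-! ### Comparison of the two maximal cones -/

theorem theorem5p7 (n t : ℕ) (ht : t + 5 ≤ n) (α : ℝ) (hα : 0 ≤ α)
    (d d' : Fin n → ℕ) (hstar : IsStarMajorizedBy d d') (hexc : ¬ IsExceptionalPair t d d')
    (G G' : SimpleGraph (Fin n))
    (hG : IsThetaMaximal α (coneCyclicClass d t 2) G)
    (hG' : IsThetaMaximal α (coneCyclicClass d' t 2) G') :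
    generalSpectralRadius G α < generalSpectralRadius G' α := by
  classical
  obtain ⟨-, -, p, q, hlt, hp, hq, hpq⟩ := hstar
  obtain ⟨htn, hd, H, hH, ⟨e⟩, τ, hτ⟩ := exists_of_mem_coneCyclicClass hG.1
  obtain ⟨-, hd', H', hH', -, τ', hτ'⟩ := exists_of_mem_coneCyclicClass hG'.1
  obtain ⟨w⟩ := hH.1.nonempty
  have : Nonempty (Fin t ⊕ Fin (n - t)) := ⟨Sum.inr w⟩
  obtain ⟨g, hpos, hg⟩ := exists_perron_vector _
    (graphJoin_connected (⊤ : SimpleGraph (Fin t)) hH.1) α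
  have hE := hG.isExtremalWeight hα htn hH e τ hτ hpos hg
  -- As `d' p = d p + 1` is a degree, `d p < n - 1`; hence both positions belong to vertices of `H`,
  -- not to the clique.
  have hp_lt : d p + 2 ≤ n := by
    have h := vdeg_lt_card (graphJoin (⊤ : SimpleGraph (Fin t)) H') (τ' p)
    rw [hτ', hp] at h
    simp only [Fintype.card_sum, Fintype.card_fin] at h
    omega
  have hdpq : d q ≤ d p := hd hlt.le
  have hinr : ∀ i, d i + 2 ≤ n → ∃ z, τ i = Sum.inr z ∧ d i = t + vdeg H z := by
    intro i hi
    have h := hτ i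
    rcases hτi : τ i with j | z
    · rw [hτi, vdeg_cone_inl htn] at h
      omega
    · rw [hτi, vdeg_cone_inr] at h
      exact ⟨z, rfl, h.symm⟩
  obtain ⟨u, hu, hdu⟩ := hinr p hp_lt
  obtain ⟨v, hv, hdv⟩ := hinr q (by omega)
  have huv : u ≠ v := by
    rintro rfl
    exact hlt.ne (τ.injective (hu.trans hv.symm))
  -- The base graph of the second cone has no isolated vertex, so `v` has degree at least two in
  -- `H`.
  have hdq : t + 1 ≤ d' q := by
    rw [← hτ' q]
    rcases τ' q with j | z
    · rw [vdeg_cone_inl htn]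
      omega
    · rw [vdeg_cone_inr]
      obtain ⟨c, hc⟩ : ∃ c : Fin (n - t), c ≠ z := by
        by_contra hcon
        push Not at hcon
        have h1 : Fintype.card (Fin (n - t)) ≤ 1 :=
          Fintype.card_le_one_iff.2 fun x y => (hcon x).trans (hcon y).symm
        rw [Fintype.card_fin] at h1
        omega
      have := hH'.1.vdeg_pos hc.symm
      omega
  -- The base graph of the second cone has at least four nonleaves, and position `q` counts as a
  -- nonleaf for `d` but not for `d'`.
  have h5 : vdeg H v = 2 → 5 ≤ (nonleaves H).card := by
    intro h2
    have h4 := hH'.four_le_card_nonleaves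
    have h1 := card_filter_eq_add_nonleaves (by omega) τ hτ
    have h1' := card_filter_eq_add_nonleaves (by omega) τ' hτ'
    have hpt : ∀ i, (if t + 2 ≤ d' i then 1 else 0) + (if i = q then 1 else 0) ≤
        if t + 2 ≤ d i then 1 else 0 := by
      intro i
      by_cases hiq : i = q
      · subst hiq
        rw [if_pos rfl, if_neg (by omega), if_pos (by omega)]
      by_cases hip : i = p
      · subst hip
        rw [if_neg hiq, if_pos (by omega), if_pos (by omega)]
      rw [if_neg hiq, hpq i hip hiq]
      simp
    have hsum := Finset.sum_le_sum fun i (_ : i ∈ (Finset.univ : Finset (Fin n))) => hpt i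
    rw [Finset.sum_add_distrib, h1, h1', Finset.sum_ite_eq' Finset.univ q,
      if_pos (Finset.mem_univ q)] at hsum
    omega
  have h3 : vdeg H v = 3 → 4 ≤ vdeg H u →
      ∀ u₂ v₂ : Fin (n - t), ∃ z, z ≠ u₂ ∧ z ≠ v₂ ∧ 3 ≤ vdeg H z := by
    intro h3 h4 u₂ v₂
    by_contra hcon
    push Not at hcon
    refine hexc (isExceptionalPair_of_cone hd hd' hp hq hpq hH htn τ hτ huv hu hv rfl h3 h4
      (by omega) fun z hzu hzv => ?_)
    by_contra hz
    have hmem : ∀ x, 3 ≤ vdeg H x → x = u₂ ∨ x = v₂ := by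
      intro x hx
      by_contra h
      push Not at h
      have := hcon x h.1 h.2
      omega
    rcases hmem u (by omega) with h1 | h1 <;> rcases hmem v (by omega) with h2 | h2 <;>
      rcases hmem z (by omega) with h3 | h3 <;>
      first
      | exact huv (h1.trans h2.symm)
      | exact hzu (h3.trans h1.symm)
      | exact hzv (h3.trans h2.symm)
  obtain ⟨u₂, v₂, H₂, huv₂, hu₂, hv₂, hH₂, hdeg, hquad, z, hz⟩ :=
    hE.improvable (a := vdeg H u) (b := vdeg H v) (by omega) (by omega)
      (by rw [Fintype.card_fin]; omega) (by rw [Fintype.card_fin]; omega) h5 h3 huv rfl rfl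
  obtain ⟨ρ, hρu, hρv, hρ⟩ := exists_perm_map_pair huv huv₂ hu₂.symm hv₂.symm
  have hΘ : generalSpectralRadius (graphJoin (⊤ : SimpleGraph (Fin t)) H) α <
      generalSpectralRadius (graphJoin (⊤ : SimpleGraph (Fin t)) H₂) α := by
    refine spectralRadius_lt_of_mrow_ne _ _ g
      (fun h0 => (hpos (Sum.inr w)).ne' (congrFun h0 _)) hg ?_ (Sum.inr z) ?_
    · have := quadForm_join_sub (⊤ : SimpleGraph (Fin t)) H H₂ α g
      linarith
    · have := mrow_join_inr_sub (⊤ : SimpleGraph (Fin t)) H H₂ α g z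
      intro h
      linarith
  rw [generalSpectralRadius_iso e]
  refine hΘ.trans_le (hG'.le_of_cone hH₂ (τ.trans (Equiv.sumCongr (Equiv.refl _) ρ)) fun i => ?_)
  have hτi := hτ i
  rw [Equiv.trans_apply]
  rcases hi : τ i with j | y
  · rw [Equiv.sumCongr_apply, Sum.map_inl, vdeg_cone_inl htn]
    rw [hi, vdeg_cone_inl htn] at hτi
    rw [hτi]
    refine hpq i ?_ ?_
    · rintro rfl
      rw [hi] at hu
      cases hu
    · rintro rfl
      rw [hi] at hv
      cases hv
  · rw [Equiv.sumCongr_apply, Sum.map_inr, vdeg_cone_inr]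
    rw [hi, vdeg_cone_inr] at hτi
    have h := hdeg (ρ y)
    rw [hρ y, ← hρu, ← hρv] at h
    simp only [ρ.injective.eq_iff] at h
    by_cases hip : i = p
    · have hyu : y = u := Sum.inr_injective (by rw [← hi, hip, hu])
      rw [hip] at hτi ⊢
      rw [if_pos hyu, if_neg (hyu ▸ huv)] at h
      omega
    by_cases hiq : i = q
    · have hyv : y = v := Sum.inr_injective (by rw [← hi, hiq, hv])
      rw [hiq] at hτi ⊢
      rw [if_pos hyv, if_neg (hyv ▸ huv.symm)] at h
      omega
    · have hyu : y ≠ u := by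
        rintro rfl
        exact hip (τ.injective (hi.trans hu.symm))
      have hyv : y ≠ v := by
        rintro rfl
        exact hiq (τ.injective (hi.trans hv.symm))
      rw [if_neg hyu, if_neg hyv] at h
      have := hpq i hip hiq
      omega
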